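/- Let $M$ be a smooth manifold of dimension $2n+1$, $n\ge 1$, and let $\eta$ be a contact form on $M$, i.e. a smooth $1$-form such that $\eta\wedge(d\eta)^{n}$ vanishes nowhere, where $d\eta(X,Y)=X(\eta(Y))-Y(\eta(X))-\eta([X,Y])$. Let $\sharp_\eta:T^*M\to TM$ be the inverse of the isomorphism $\flat_\eta(X)=-i_Xd\eta+\eta(X)\eta$, let $\xi=\sharp_\eta(\eta)$ be the Reeb field, and let $\pi(\alpha,\beta)=d\eta(\sharp_\eta(\alpha),\sharp_\eta(\beta))$. Let $g$ be a pseudo-Riemannian metric on $M$ such that $(M,\eta,g)$ is contact pseudo-Riemannian: there is a smooth field $\Phi$ of endomorphisms of $TM$ with $\Phi^2=-\mathrm{Id}+\eta\otimes\xi$, $\eta(\xi)=1$, $g(\Phi X,\Phi Y)=g(X,Y)-\eta(X)\eta(Y)$ and $g(X,\Phi Y)=d\eta(X,Y)$. Write $\flat_g(X)=g(X,\cdot)$, $\sharp_g=\flat_g^{-1}$, $g^*(\alpha,\beta)=g(\sharp_g\alpha,\sharp_g\beta)$. Let $\sharp_\pi$ be defined by $\beta(\sharp_\pi(\alpha))=\pi(\alpha,\beta)$,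 put $\sharp_{\pi,\xi}(\alpha)=\sharp_\pi(\alpha)+\alpha(\xi)\xi$, let $J$ be the field of endomorphisms of $TM$ with $g(J\sharp_g\alpha,\sharp_g\beta)=\pi(\alpha,\beta)$, and let $\lambda=g(\xi,\xi)\flat_g(\xi)-\flat_g(J\xi)$. For $\alpha,\beta\in\Omega^1(M)$ put $$[\alpha,\beta]^g_{\pi,\xi}=\mathcal L_{\sharp_\pi\alpha}\beta-\mathcal L_{\sharp_\pi\beta}\alpha-d(\pi(\alpha,\beta))+\alpha(\xi)(\mathcal L_\xi\beta-\beta)-\beta(\xi)(\mathcal L_\xi\alpha-\alpha)-\pi(\alpha,\beta)\lambda .$$ Then there is a unique map $\mathcal D:\Omega^1(M)\times\Omega^1(M)\to\Omega^1(M)$, biadditive, $C^\infty(M)$-linear in the first argument, with $\mathcal D_\alpha(f\beta)=f\mathcal D_\alpha\beta+(\sharp_{\pi,\xi}(\alpha)\cdot f)\beta$, symmetric in the sense that $\mathcal D_\alpha\beta-\mathcal D_\beta\alpha=[\alpha,\beta]^g_{\pi,\xi}$, and compatible with the metric in the sense that $\sharp_{\pi,\xi}(\alpha)\cdot g^*(\beta,\gamma)=g^*(\mathcal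 D_\alpha\beta,\gamma)+g^*(\beta,\mathcal D_\alpha\gamma)$ (the contravariant Levi-Civita derivative of $(\pi,\xi,g)$). Moreover $g$ has a Levi-Civita connection $\nabla$ (torsion-free and metric), and $$\sharp_\eta(\mathcal D_\alpha\beta)=\nabla_{\sharp_\eta(\alpha)}\sharp_\eta(\beta)\qquad\text{for all }\alpha,\beta\in\Omega^1(M).$$ In addition, $\lambda=\eta$, and $\Phi=-J$ for every $\Phi$ as above. -/

import Mathlib

open Bundle Module VectorField FiberBundle
open scoped Manifold ContDiff

noncomputable section

namespace ContactJacobi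

variable {E : Type*} [NormedAddCommGroup E] [NormedSpace ℝ E]
  {M : Type*} [TopologicalSpace M] [ChartedSpace E M]

/-! ### Tensor fields -/

/-- The cotangent space `T*_x M`. -/
abbrev Cotangent (E : Type*) [NormedAddCommGroup E] [NormedSpace ℝ E]
    {M : Type*} [TopologicalSpace M] [ChartedSpace E M] (x : M) : Type _ :=
  TangentSpace 𝓘(ℝ, E) x →L[ℝ] ℝ

/-- Fields of tangent vectors, with no regularity imposed. -/
abbrev VField (E : Type*) [NormedAddCommGroup E] [NormedSpace ℝ E]
    (M : Type*) [TopologicalSpace M] [ChartedSpace E M] : Type _ :=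
  Π x : M, TangentSpace 𝓘(ℝ, E) x

/-- Fields of covectors, with no regularity imposed. -/
abbrev CovField (E : Type*) [NormedAddCommGroup E] [NormedSpace ℝ E]
    (M : Type*) [TopologicalSpace M] [ChartedSpace E M] : Type _ :=
  Π x : M, Cotangent E x

/-- Fields of bivectors, seen as bilinear forms on the cotangent spaces. -/
abbrev BivField (E : Type*) [NormedAddCommGroup E] [NormedSpace ℝ E]
    (M : Type*) [TopologicalSpace M] [ChartedSpace E M] : Type _ :=
  Π x : M, Cotangent E x →ₗ[ℝ] Cotangent E x →ₗ[ℝ] ℝ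

/-- The space `Ω¹(M)` of smooth differential 1-forms. -/
abbrev OneForm (E : Type*) [NormedAddCommGroup E] [NormedSpace ℝ E]
    (M : Type*) [TopologicalSpace M] [ChartedSpace E M] [IsManifold 𝓘(ℝ, E) ∞ M] : Type _ :=
  Cₛ^∞⟮𝓘(ℝ, E); E →L[ℝ] ℝ, fun x : M ↦ TangentSpace 𝓘(ℝ, E) x →L[ℝ] ℝ⟯

/-- Smooth fields of endomorphisms of the tangent bundle. -/
abbrev EndField (E : Type*) [NormedAddCommGroup E] [NormedSpace ℝ E]
    (M : Type*) [TopologicalSpace M] [ChartedSpace E M] [IsManifold 𝓘(ℝ, E) ∞ M] : Type _ :=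
  Cₛ^∞⟮𝓘(ℝ, E); E →L[ℝ] E,
    fun x : M ↦ TangentSpace 𝓘(ℝ, E) x →L[ℝ] TangentSpace 𝓘(ℝ, E) x⟯

/-- A smooth pseudo-Riemannian metric: a smooth field of nondegenerate symmetric bilinear forms
on the tangent spaces, of arbitrary signature. -/
structure PseudoRiemannianMetric (E : Type*) [NormedAddCommGroup E] [NormedSpace ℝ E]
    (M : Type*) [TopologicalSpace M] [ChartedSpace E M] [IsManifold 𝓘(ℝ, E) ∞ M] where
  val : Π x : M, TangentSpace 𝓘(ℝ, E) x →L[ℝ] TangentSpace 𝓘(ℝ, E) x →L[ℝ] ℝ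
  symm : ∀ (x : M) (u v : TangentSpace 𝓘(ℝ, E) x), val x u v = val x v u
  nondegenerate : ∀ (x : M) (u : TangentSpace 𝓘(ℝ, E) x), (∀ v, val x u v = 0) → u = 0
  contMDiff : ContMDiff 𝓘(ℝ, E) (𝓘(ℝ, E).prod 𝓘(ℝ, E →L[ℝ] E →L[ℝ] ℝ)) ∞
    (fun x ↦ TotalSpace.mk' (E →L[ℝ] E →L[ℝ] ℝ) x (val x))

instance [FiniteDimensional ℝ E] (x : M) : FiniteDimensional ℝ (TangentSpace 𝓘(ℝ, E) x) :=
  inferInstanceAs (FiniteDimensional ℝ E)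

instance (x : M) : T2Space (TangentSpace 𝓘(ℝ, E) x) :=
  inferInstanceAs (T2Space E)

section Calculus

variable [IsManifold 𝓘(ℝ, E) ∞ M]

/-- The product `f α` of a smooth function and a smooth 1-form. -/
def fsmul (f : C^∞⟮𝓘(ℝ, E), M; ℝ⟯) (α : OneForm E M) : OneForm E M :=
  ⟨fun x ↦ f x • α x, f.contMDiff.smul_section α.contMDiff⟩

/-! ### Exterior derivative and Lie derivative of 1-forms -/

/-- The expression `X(β(Y)) - Y(β(X)) - β([X, Y])`. -/
def extDerivAux (β : OneForm E M) (x : M) (X Y : VField E M) : ℝ :=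
  mvfderiv 𝓘(ℝ, E) (fun y ↦ β y (Y y)) x (X x) - mvfderiv 𝓘(ℝ, E) (fun y ↦ β y (X y)) x (Y x)
    - β x (mlieBracket 𝓘(ℝ, E) X Y x)

theorem mdifferentiableAt_oneForm_apply (β : OneForm E M) {x : M} {Y : VField E M}
    (hY : MDiffAt (T% Y) x) : MDiffAt (fun y ↦ β y (Y y)) x := by
  have h : MDifferentiableAt 𝓘(ℝ, E) (𝓘(ℝ, E).prod 𝓘(ℝ))
      (fun y ↦ TotalSpace.mk' ℝ (E := Bundle.Trivial M ℝ) y (β y (Y y))) x := by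
    apply MDifferentiableAt.clm_bundle_apply (F₁ := E)
    · exact (β.contMDiff x).mdifferentiableAt (by simp)
    · exact hY
  rw [mdifferentiableAt_totalSpace] at h
  exact h.2

theorem extDerivAux_swap (β : OneForm E M) (x : M) (X Y : VField E M) :
    extDerivAux β x X Y = -extDerivAux β x Y X := by
  simp only [extDerivAux]
  rw [mlieBracket_swap_apply, map_neg]
  ring

variable [FiniteDimensional ℝ E]

theorem extDerivAux_tensorial_right (β : OneForm E M) (x : M) (X : VField E M)
    (_ : MDiffAt (T% X) x) : TensorialAt 𝓘(ℝ, E) E (extDerivAux β x X) x where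
  smul {f Y} hf hY := by
    have h1 := mdifferentiableAt_oneForm_apply β hY
    have e1 : (fun y ↦ β y ((f • Y) y)) = fun y ↦ f y * β y (Y y) := by
      ext y; simp
    simp only [extDerivAux]
    rw [mlieBracket_smul_right hf hY, e1, mvfderiv_fun_mul hf h1]
    simp
    ring
  add {Y Z} hY hZ := by
    have h1 := mdifferentiableAt_oneForm_apply β hY
    have h2 := mdifferentiableAt_oneForm_apply β hZ
    have e1 : (fun y ↦ β y ((Y + Z) y)) = fun y ↦ β y (Y y) + β y (Z y) := by
      ext y; simp
    simp only [extDerivAux]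
    rw [mlieBracket_add_right hY hZ, e1, mvfderiv_fun_add h1 h2]
    simp
    ring

theorem extDerivAux_tensorial_left (β : OneForm E M) (x : M) (Y : VField E M)
    (hY : MDiffAt (T% Y) x) : TensorialAt 𝓘(ℝ, E) E (extDerivAux β x · Y) x where
  smul hf hX := by
    rw [extDerivAux_swap, (extDerivAux_tensorial_right β x Y hY).smul hf hX,
      extDerivAux_swap β x _ Y, smul_neg]
  add hX hX' := by
    rw [extDerivAux_swap, (extDerivAux_tensorial_right β x Y hY).add hX hX',
      extDerivAux_swap β x _ Y, extDerivAux_swap β x _ Y, neg_add]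

/-- The exterior derivative `dβ` of a smooth 1-form: the 2-form with
`dβ(X, Y) = X(β(Y)) - Y(β(X)) - β([X, Y])`. -/
def extDeriv₁ (β : OneForm E M) (x : M) :
    TangentSpace 𝓘(ℝ, E) x →L[ℝ] TangentSpace 𝓘(ℝ, E) x →L[ℝ] ℝ :=
  TensorialAt.mkHom₂ (extDerivAux β x) x
    (extDerivAux_tensorial_left β x) (extDerivAux_tensorial_right β x)

theorem extDeriv₁_apply (β : OneForm E M) {x : M} {X Y : VField E M}
    (hX : MDiffAt (T% X) x) (hY : MDiffAt (T% Y) x) :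
    extDeriv₁ β x (X x) (Y x) =
      mvfderiv 𝓘(ℝ, E) (fun y ↦ β y (Y y)) x (X x) - mvfderiv 𝓘(ℝ, E) (fun y ↦ β y (X y)) x (Y x)
        - β x (mlieBracket 𝓘(ℝ, E) X Y x) :=
  TensorialAt.mkHom₂_apply _ _ hX hY

/-- The Lie derivative `L_X β = d(β(X)) + i_X dβ` of a smooth 1-form. -/
def lieDeriv (X : VField E M) (β : OneForm E M) : CovField E M := fun x ↦
  mvfderiv 𝓘(ℝ, E) (fun y ↦ β y (X y)) x + extDeriv₁ β x (X x)

/-- The Lie derivative is given by `(L_X β)(Y) = X(β(Y)) - β([X, Y])`. -/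
theorem lieDeriv_apply (β : OneForm E M) {x : M} {X Y : VField E M}
    (hX : MDiffAt (T% X) x) (hY : MDiffAt (T% Y) x) :
    lieDeriv X β x (Y x) = mvfderiv 𝓘(ℝ, E) (fun y ↦ β y (Y y)) x (X x)
      - β x (mlieBracket 𝓘(ℝ, E) X Y x) := by
  simp only [lieDeriv, _root_.add_apply, extDeriv₁_apply β hX hY]
  ring

/-! ### The skew algebroid of a triple `(π, ξ, λ)` -/

/-- `♯_π`, characterized by `β(♯_π(α)) = π(α, β)`. -/
def sharpBiv (P : BivField E M) (x : M) : Cotangent E x →ₗ[ℝ] TangentSpace 𝓘(ℝ, E) x :=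
  (evalEquiv ℝ (TangentSpace 𝓘(ℝ, E) x)).symm.toLinearMap ∘ₗ
    (LinearMap.lcomp ℝ ℝ
      (LinearMap.toContinuousLinearMap (𝕜 := ℝ) (E := TangentSpace 𝓘(ℝ, E) x)
        (F' := ℝ)).toLinearMap) ∘ₗ P x

theorem apply_sharpBiv (P : BivField E M) (x : M) (a b : Cotangent E x) :
    b (sharpBiv P x a) = P x a b := by
  have h := apply_evalEquiv_symm_apply ℝ (TangentSpace 𝓘(ℝ, E) x) (b : _ →ₗ[ℝ] ℝ)
    ((P x a) ∘ₗ (LinearMap.toContinuousLinearMap (𝕜 := ℝ) (E := TangentSpace 𝓘(ℝ, E) x)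
        (F' := ℝ)).toLinearMap)
  exact h

/-- The anchor `♯_{π,ξ}(α) = ♯_π(α) + α(ξ) ξ`. -/
def anchor (P : BivField E M) (ξ : VField E M) (x : M) (a : Cotangent E x) :
    TangentSpace 𝓘(ℝ, E) x :=
  sharpBiv P x a + a (ξ x) • ξ x

/-- The Koszul bracket `[α, β]_π = L_{♯_π(α)} β - L_{♯_π(β)} α - d(π(α, β))`. -/
def koszulBracket (P : BivField E M) (α β : OneForm E M) : CovField E M := fun x ↦
  lieDeriv (fun y ↦ sharpBiv P y (α y)) β x - lieDeriv (fun y ↦ sharpBiv P y (β y)) α x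
    - mvfderiv 𝓘(ℝ, E) (fun y ↦ P y (α y) (β y)) x

/-- The bracket
`[α, β]_{π,ξ}^λ = [α, β]_π + α(ξ) (L_ξ β - β) - β(ξ) (L_ξ α - α) - π(α, β) λ`. -/
def skewBracket (P : BivField E M) (ξ : VField E M) (l : CovField E M) (α β : OneForm E M) :
    CovField E M := fun x ↦
  koszulBracket P α β x + α x (ξ x) • (lieDeriv ξ β x - β x) - β x (ξ x) • (lieDeriv ξ α x - α x)
    - P x (α x) (β x) • l x

/-! ### Musical isomorphisms and the contravariant Levi-Civita derivative -/

theorem isInvertible_of_injective {x : M}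
    {A : TangentSpace 𝓘(ℝ, E) x →L[ℝ] Cotangent E x} (hA : Function.Injective A) :
    A.IsInvertible := by
  let e : Dual ℝ (TangentSpace 𝓘(ℝ, E) x) ≃ₗ[ℝ] Cotangent E x :=
    LinearMap.toContinuousLinearMap
  have : FiniteDimensional ℝ (Cotangent E x) := e.finiteDimensional
  have hd : finrank ℝ (TangentSpace 𝓘(ℝ, E) x) = finrank ℝ (Cotangent E x) := by
    rw [← e.finrank_eq, Subspace.dual_finrank_eq]
  exact ⟨(LinearEquiv.ofInjectiveOfFinrankEq A.toLinearMap hA hd).toContinuousLinearEquiv,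
    by ext; rfl⟩

/-- `♯_g`, the inverse of the isomorphism `♭_g : X ↦ g(X, ·)`. -/
def sharpMetric (g : PseudoRiemannianMetric E M) (x : M) :
    Cotangent E x →L[ℝ] TangentSpace 𝓘(ℝ, E) x :=
  (g.val x).inverse

theorem sharpMetric_spec (g : PseudoRiemannianMetric E M) (x : M) :
    (∀ a : Cotangent E x, g.val x (sharpMetric g x a) = a) ∧
      ∀ v : TangentSpace 𝓘(ℝ, E) x, sharpMetric g x (g.val x v) = v := by
  have h := isInvertible_of_injective (A := g.val x) (fun u v huv ↦ by
    have := g.nondegenerate x (u - v) (fun w ↦ by simp [huv])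
    exact sub_eq_zero.mp this)
  exact ⟨fun a ↦ h.self_apply_inverse a, fun v ↦ h.inverse_apply_self v⟩

/-- The cometric `g*(α, β) = g(♯_g(α), ♯_g(β))`. -/
def cometric (g : PseudoRiemannianMetric E M) (x : M) (a b : Cotangent E x) : ℝ :=
  g.val x (sharpMetric g x a) (sharpMetric g x b)

/-- The endomorphism `J` with `g(J ♯_g(α), ♯_g(β)) = π(α, β)`, i.e.
`J(v) = ♯_g(π(♭_g(v), ♭_g(·)))`. -/
def endoJ (P : BivField E M) (g : PseudoRiemannianMetric E M) (x : M)
    (v : TangentSpace 𝓘(ℝ, E) x) : TangentSpace 𝓘(ℝ, E) x :=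
  sharpMetric g x (LinearMap.toContinuousLinearMap
    (P x (g.val x v) ∘ₗ (g.val x : TangentSpace 𝓘(ℝ, E) x →ₗ[ℝ] Cotangent E x)))

theorem endoJ_spec (P : BivField E M) (g : PseudoRiemannianMetric E M) (x : M)
    (a b : Cotangent E x) :
    g.val x (endoJ P g x (sharpMetric g x a)) (sharpMetric g x b) = P x a b := by
  simp [endoJ, (sharpMetric_spec g x).1]

/-- The 1-form `λ = g(ξ, ξ) ♭_g(ξ) - ♭_g(J ξ)`. -/
def lambdaForm (P : BivField E M) (ξ : VField E M) (g : PseudoRiemannianMetric E M) :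
    CovField E M := fun x ↦
  g.val x (ξ x) (ξ x) • g.val x (ξ x) - g.val x (endoJ P g x (ξ x))

/-- `D` is a contravariant Levi-Civita derivative of the triple `(π, ξ, g)`: a contravariant
derivative with respect to the anchor `♯_{π,ξ}` that is symmetric with respect to the bracket
`[·,·]_{π,ξ}^g = [·,·]_{π,ξ}^λ`, where `λ = g(ξ, ξ) ♭_g(ξ) - ♭_g(J ξ)`, and compatible with the
metric. -/
structure IsContravariantLeviCivita (P : BivField E M) (ξ : VField E M)
    (g : PseudoRiemannianMetric E M) (D : OneForm E M → OneForm E M → OneForm E M) : Prop where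
  add_left : ∀ α α' β, D (α + α') β = D α β + D α' β
  smul_left : ∀ (f : C^∞⟮𝓘(ℝ, E), M; ℝ⟯) (α β), D (fsmul f α) β = fsmul f (D α β)
  add_right : ∀ α β β', D α (β + β') = D α β + D α β'
  leibniz : ∀ (f : C^∞⟮𝓘(ℝ, E), M; ℝ⟯) (α β) (x : M), D α (fsmul f β) x =
    f x • D α β x + mvfderiv 𝓘(ℝ, E) f x (anchor P ξ x (α x)) • β x
  symmetric : ∀ (α β) (x : M),
    D α β x - D β α x = skewBracket P ξ (lambdaForm P ξ g) α β x
  metric : ∀ (α β γ) (x : M),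
    mvfderiv 𝓘(ℝ, E) (fun y ↦ cometric g y (β y) (γ y)) x (anchor P ξ x (α x)) =
      cometric g x (D α β x) (γ x) + cometric g x (β x) (D α γ x)

/-- `∇` is a Levi-Civita connection of `g`: it is torsion-free and compatible with `g`. The
value of `∇_X Y` at `x` is `∇ Y x (X x)`. -/
structure IsLeviCivita (g : PseudoRiemannianMetric E M)
    (nabla : CovariantDerivative 𝓘(ℝ, E) E (TangentSpace 𝓘(ℝ, E) : M → Type _)) : Prop where
  torsion_eq_zero : nabla.torsion = 0
  metric : ∀ (x : M) (X Y Z : VField E M),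
    MDiffAt (T% X) x → MDiffAt (T% Y) x → MDiffAt (T% Z) x →
    mvfderiv 𝓘(ℝ, E) (fun y ↦ g.val y (Y y) (Z y)) x (X x) =
      g.val x (nabla Y x (X x)) (Z x) + g.val x (Y x) (nabla Z x (X x))

/-! ### Contact forms and associated metrics -/

/-- The form `η ∧ (dη)^n`, with the convention
`(α ∧ β)(v₁, …, v_{p+q}) = 1/(p! q!) ∑_σ sign(σ) α(v_σ(1), …) β(v_σ(p+1), …)`. -/
def contactTopForm (n : ℕ) (η : OneForm E M) (x : M)
    (v : Fin (2 * n + 1) → TangentSpace 𝓘(ℝ, E) x) : ℝ :=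
  (1 / 2 ^ n) * ∑ σ : Equiv.Perm (Fin (2 * n + 1)), ((Equiv.Perm.sign σ : ℤ) : ℝ) *
    (η x (v (σ 0)) * ∏ i : Fin n,
      extDeriv₁ η x (v (σ ⟨2 * i + 1, by omega⟩)) (v (σ ⟨2 * i + 2, by omega⟩)))

/-- `η` is a contact form on a manifold of dimension `2n + 1`: `η ∧ (dη)^n` vanishes nowhere. -/
def IsContactForm (n : ℕ) (η : OneForm E M) : Prop :=
  finrank ℝ E = 2 * n + 1 ∧ ∀ x, ∃ v, contactTopForm n η x v ≠ 0

/-- `♭_η(X) = -i_X dη + η(X) η`. -/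
def flatEta (η : OneForm E M) (x : M) : TangentSpace 𝓘(ℝ, E) x →L[ℝ] Cotangent E x :=
  -(extDeriv₁ η x) + (η x).smulRight (η x)

/-- `♯_η`, the inverse of the isomorphism `♭_η` of a contact form. -/
def sharpEta (η : OneForm E M) (x : M) : Cotangent E x →L[ℝ] TangentSpace 𝓘(ℝ, E) x :=
  (flatEta η x).inverse

/-- The Reeb field `ξ = ♯_η(η)`. -/
def reeb (η : OneForm E M) : VField E M := fun x ↦ sharpEta η x (η x)

/-- The bivector field `π(α, β) = dη(♯_η(α), ♯_η(β))`. -/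
def contactBivector (η : OneForm E M) : BivField E M := fun x ↦
  (ContinuousLinearMap.coeLM ℝ ∘ₗ (extDeriv₁ η x).toLinearMap).compl₁₂
    (sharpEta η x).toLinearMap (sharpEta η x).toLinearMap

/-- `(Φ, ξ, η, g)` is an almost contact pseudo-Riemannian structure: the fields are smooth,
`Φ² = -Id + η ⊗ ξ`, `η(ξ) = 1` and `g(ΦX, ΦY) = g(X, Y) - η(X) η(Y)`. -/
structure IsAlmostContactMetric (Phi : EndField E M) (ξ : VField E M) (η : OneForm E M)
    (g : PseudoRiemannianMetric E M) : Prop where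
  smooth : ContMDiff 𝓘(ℝ, E) 𝓘(ℝ, E).tangent ∞ (T% ξ)
  sq : ∀ (x : M) (u : TangentSpace 𝓘(ℝ, E) x), Phi x (Phi x u) = -u + η x u • ξ x
  eta_xi : ∀ x, η x (ξ x) = 1
  metric : ∀ (x : M) (u v : TangentSpace 𝓘(ℝ, E) x),
    g.val x (Phi x u) (Phi x v) = g.val x u v - η x u * η x v

/-- `Φ` makes the metric `g` associated with the contact form `η`: `(Φ, ξ, η, g)`, with `ξ` the
Reeb field, is an almost contact pseudo-Riemannian structure with `g(X, ΦY) = dη(X, Y)`. -/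
def IsAssociatedEndo (η : OneForm E M) (g : PseudoRiemannianMetric E M) (Phi : EndField E M) :
    Prop :=
  IsAlmostContactMetric Phi (reeb η) η g ∧
    ∀ (x : M) (u v : TangentSpace 𝓘(ℝ, E) x), g.val x u (Phi x v) = extDeriv₁ η x u v

/-- `(M, η, g)` is a contact pseudo-Riemannian manifold of dimension `2n + 1`. -/
def IsContactPseudoRiemannian (n : ℕ) (η : OneForm E M) (g : PseudoRiemannianMetric E M) : Prop :=
  IsContactForm n η ∧ ∃ Phi : EndField E M, IsAssociatedEndo η g Phi

end Calculus

end ContactJacobi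

end

open ContactJacobi

noncomputable section

set_option linter.unusedSectionVars false

open scoped Topology

/-! The isomorphism `♯_η : T*M → TM` carries every ingredient of the contravariant Levi-Civita
derivative of `(π, ξ, g)` to the corresponding ingredient of the ordinary Levi-Civita connection of
`g`.

Three facts carry the proof. The anchor `♯_{π,ξ}` is `♯_η` itself (`anchor_eq`). The map `♯_η` is an
isometry from `g*` to `g` (`cometric_eq`): `♭_η` is `♭_g` composed with `Φ + η ⊗ ξ`, an isometry of
`g` with inverse `-Φ + η ⊗ ξ`. Finally `♯_η` sends the bracket of 1-forms to the Lie bracket of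
vector fields (`skewBracket_eq`). This last fact is the computational core: since `λ = η`, it
reduces, after writing `α = -i_X dη + η(X) η` with `X = ♯_η(α)`, to the closedness of `dη`.

Hence `♭_η(∇_{♯_η α} ♯_η β)` satisfies the axioms required of `D` whenever `∇` is torsion-free and
metric. Existence of `∇` comes from the Koszul formula. Uniqueness of `D` is the usual argument: the
difference of two solutions is symmetric in its arguments and skew for the cometric, hence zero.
Uniqueness also yields the formula relating `D` and `∇`. -/

namespace ContactJacobi

/-! ### Global extension of sections, Lie brackets and the identity `d² = 0` on 1-forms. -/

section Preliminaries

section Extension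

variable {E : Type*} [NormedAddCommGroup E] [NormedSpace ℝ E] [FiniteDimensional ℝ E]
  {M : Type*} [TopologicalSpace M] [T2Space M] [ChartedSpace E M] [IsManifold 𝓘(ℝ, E) ∞ M]
  {F : Type*} [NormedAddCommGroup F] [NormedSpace ℝ F]
  {V : M → Type*} [TopologicalSpace (TotalSpace F V)]
  [∀ x, AddCommGroup (V x)] [∀ x, Module ℝ (V x)] [∀ x, TopologicalSpace (V x)]
  [FiberBundle F V] [VectorBundle ℝ F V]

/-- A section that is smooth near `x` coincides near `x` with a global smooth section. -/
theorem exists_contMDiff_section_eventuallyEq {x : M} {u : Set M} (hu : u ∈ 𝓝 x)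
    {s : Π y, V y} (hs : CMDiff[u] ∞ (T% s)) :
    ∃ t : Π y, V y, CMDiff ∞ (T% t) ∧ ∀ᶠ y in 𝓝 x, t y = s y := by
  obtain ⟨f, -, hf⟩ := (SmoothBumpFunction.nhds_basis_tsupport (I := 𝓘(ℝ, E)) x).mem_iff.1
    (interior_mem_nhds.2 hu)
  refine ⟨fun y ↦ f y • s y, ?_, ?_⟩
  · exact ContMDiffOn.smul_section_of_tsupport f.contMDiff.contMDiffOn isOpen_interior hf
      (hs.mono interior_subset)
  · filter_upwards [f.eventuallyEq_one] with y hy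
    simp [hy]

variable (F) in
/-- Every element of a fibre is the value of a global smooth section. -/
theorem exists_contMDiff_section_apply_eq [ContMDiffVectorBundle ∞ F V 𝓘(ℝ, E)]
    {x : M} (v : V x) : ∃ t : Π y, V y, CMDiff ∞ (T% t) ∧ t x = v := by
  obtain ⟨u, hu, hs⟩ := exists_contMDiffOn_extend (k := ∞) 𝓘(ℝ, E) F v
  obtain ⟨t, ht, hts⟩ := exists_contMDiff_section_eventuallyEq hu hs
  exact ⟨t, ht, by simpa using hts.self_of_nhds⟩

end Extension

variable {E : Type*} [NormedAddCommGroup E] [NormedSpace ℝ E]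
  {M : Type*} [TopologicalSpace M] [ChartedSpace E M] [IsManifold 𝓘(ℝ, E) ∞ M]

theorem mdiffAt_vectorField {X : VField E M} (hX : CMDiff ∞ (T% X)) (x : M) : MDiffAt (T% X) x :=
  (hX x).mdifferentiableAt (by simp)

theorem mdiffAt_function {f : M → ℝ} (hf : CMDiff ∞ f) (x : M) : MDiffAt f x :=
  (hf x).mdifferentiableAt (by simp)

theorem contMDiff_oneForm_apply {a : CovField E M}
    (ha : ContMDiff 𝓘(ℝ, E) (𝓘(ℝ, E).prod 𝓘(ℝ, E →L[ℝ] ℝ)) ∞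
      (fun x ↦ TotalSpace.mk' (E →L[ℝ] ℝ) (E := fun x : M ↦ TangentSpace 𝓘(ℝ, E) x →L[ℝ] ℝ) x
        (a x)))
    {Y : VField E M} (hY : CMDiff ∞ (T% Y)) : CMDiff ∞ (fun y ↦ a y (Y y)) := by
  have h : ContMDiff 𝓘(ℝ, E) (𝓘(ℝ, E).prod 𝓘(ℝ)) ∞
      (fun y ↦ TotalSpace.mk' ℝ (E := Bundle.Trivial M ℝ) y (a y (Y y))) :=
    ContMDiff.clm_bundle_apply (F₁ := E) ha hY
  intro x
  exact (contMDiffAt_totalSpace.1 (h x)).2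

theorem contMDiff_smul_vectorField {f : M → ℝ} {X : VField E M} (hf : CMDiff ∞ f)
    (hX : CMDiff ∞ (T% X)) : CMDiff ∞ (T% (f • X)) :=
  hf.smul_section hX


/-- The derivative of a smooth function along a smooth vector field is smooth. -/
theorem contMDiff_mvfderiv_apply {f : M → ℝ} {X : VField E M} (hf : CMDiff ∞ f)
    (hX : CMDiff ∞ (T% X)) : CMDiff ∞ (fun y ↦ mvfderiv 𝓘(ℝ, E) f y (X y)) := by
  intro x
  -- The function is the fibre component of the tangent map of `f` composed with `X`.
  have h := ((hf.contMDiff_tangentMap (m := ∞) (by simp)).comp hX) x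
  have := (contMDiffAt_totalSpace.1 h).2
  simpa using! this

variable [FiniteDimensional ℝ E]

theorem contMDiff_mlieBracket {X Y : VField E M} (hX : CMDiff ∞ (T% X)) (hY : CMDiff ∞ (T% Y)) :
    CMDiff ∞ (T% (mlieBracket 𝓘(ℝ, E) X Y)) := by
  have : IsManifold 𝓘(ℝ, E) (minSmoothness ℝ 2) M := by
    rw [minSmoothness_of_isRCLikeNormedField]; infer_instance
  have : IsManifold 𝓘(ℝ, E) (minSmoothness ℝ 3) M := by
    rw [minSmoothness_of_isRCLikeNormedField]; infer_instance
  have : IsManifold 𝓘(ℝ, E) (((⊤ : ℕ∞) : WithTop ℕ∞) + 1) M := ‹IsManifold 𝓘(ℝ, E) ∞ M›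
  exact ContDiff.mlieBracket_vectorField (m := ⊤) (n := ⊤) hX hY (by simp)

theorem mlieBracket_jacobi {X Y Z : VField E M} (hX : CMDiff ∞ (T% X)) (hY : CMDiff ∞ (T% Y))
    (hZ : CMDiff ∞ (T% Z)) (x : M) :
    mlieBracket 𝓘(ℝ, E) X (mlieBracket 𝓘(ℝ, E) Y Z) x =
      mlieBracket 𝓘(ℝ, E) (mlieBracket 𝓘(ℝ, E) X Y) Z x +
        mlieBracket 𝓘(ℝ, E) Y (mlieBracket 𝓘(ℝ, E) X Z) x := by
  have h3 : IsManifold 𝓘(ℝ, E) (minSmoothness ℝ 3) M := by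
    rw [minSmoothness_of_isRCLikeNormedField]; infer_instance
  have h2 : minSmoothness ℝ 2 ≤ ∞ := by
    rw [minSmoothness_of_isRCLikeNormedField]; exact ENat.LEInfty.out
  exact leibniz_identity_mlieBracket_apply ((hX x).of_le h2) ((hY x).of_le h2) ((hZ x).of_le h2)

variable [T2Space M]

theorem exists_vectorField_apply_eq {x : M} (v : TangentSpace 𝓘(ℝ, E) x) :
    ∃ X : VField E M, CMDiff ∞ (T% X) ∧ X x = v :=
  exists_contMDiff_section_apply_eq E v

theorem exists_oneForm_apply_eq {x : M} (a : Cotangent E x) : ∃ α : OneForm E M, α x = a := by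
  obtain ⟨t, ht, hx⟩ := exists_contMDiff_section_apply_eq (E := E) (E →L[ℝ] ℝ)
    (V := fun x : M ↦ TangentSpace 𝓘(ℝ, E) x →L[ℝ] ℝ) a
  exact ⟨⟨t, ht⟩, hx⟩


/-- The derivative along `[X, Y]` is the commutator of the derivatives along `X` and `Y`. -/
theorem mvfderiv_apply_mlieBracket {f : M → ℝ} {X Y : VField E M} (hf : CMDiff ∞ f)
    (hX : CMDiff ∞ (T% X)) (hY : CMDiff ∞ (T% Y)) (x : M) :
    mvfderiv 𝓘(ℝ, E) f x (mlieBracket 𝓘(ℝ, E) X Y x) =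
      mvfderiv 𝓘(ℝ, E) (fun y ↦ mvfderiv 𝓘(ℝ, E) f y (Y y)) x (X x) -
        mvfderiv 𝓘(ℝ, E) (fun y ↦ mvfderiv 𝓘(ℝ, E) f y (X y)) x (Y x) := by
  -- The commutator identity is read off from the Jacobi identity for `X`, `Y`, `f Z`: after
  -- subtracting `f` times the Jacobi identity for `X`, `Y`, `Z`, only a multiple of `Z x` remains.
  -- Cancelling it needs `Z x ≠ 0`, so dimension zero is treated apart.
  rcases subsingleton_or_nontrivial E with hE | hE
  · have h0 : ∀ v : TangentSpace 𝓘(ℝ, E) x, v = 0 := fun v ↦ Subsingleton.elim (α := E) _ _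
    simp [h0 (X x), h0 (Y x), h0 (mlieBracket 𝓘(ℝ, E) X Y x)]
  obtain ⟨v, hv⟩ := exists_ne (0 : E)
  obtain ⟨Z, hZ, hZx⟩ := exists_vectorField_apply_eq (x := x) (v : TangentSpace 𝓘(ℝ, E) x)
  have hfZ := contMDiff_smul_vectorField hf hZ
  have key : ∀ {W : VField E M}, CMDiff ∞ (T% W) → mlieBracket 𝓘(ℝ, E) W (f • Z) =
      (fun y ↦ mvfderiv 𝓘(ℝ, E) f y (W y)) • Z + f • mlieBracket 𝓘(ℝ, E) W Z := by
    intro W hW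
    funext y
    exact mlieBracket_smul_right (mdiffAt_function hf y) (mdiffAt_vectorField hZ y)
  have key2 : ∀ {U W : VField E M}, CMDiff ∞ (T% U) → CMDiff ∞ (T% W) →
      mlieBracket 𝓘(ℝ, E) U (mlieBracket 𝓘(ℝ, E) W (f • Z)) x =
        mvfderiv 𝓘(ℝ, E) (fun y ↦ mvfderiv 𝓘(ℝ, E) f y (W y)) x (U x) • Z x
        + mvfderiv 𝓘(ℝ, E) f x (W x) • mlieBracket 𝓘(ℝ, E) U Z x
        + (mvfderiv 𝓘(ℝ, E) f x (U x) • mlieBracket 𝓘(ℝ, E) W Z x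
        + f x • mlieBracket 𝓘(ℝ, E) U (mlieBracket 𝓘(ℝ, E) W Z) x) := by
    intro U W hU hW
    have hWf := contMDiff_mvfderiv_apply hf hW
    have hWZ := contMDiff_mlieBracket hW hZ
    rw [key hW, mlieBracket_add_right
      (mdiffAt_vectorField (contMDiff_smul_vectorField hWf hZ) x)
      (mdiffAt_vectorField (contMDiff_smul_vectorField hf hWZ) x),
      mlieBracket_smul_right (mdiffAt_function hWf x) (mdiffAt_vectorField hZ x),
      mlieBracket_smul_right (mdiffAt_function hf x) (mdiffAt_vectorField hWZ x)]
  have h := mlieBracket_jacobi hX hY hfZ x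
  rw [key2 hX hY, key2 hY hX, key (contMDiff_mlieBracket hX hY)] at h
  have hJ := mlieBracket_jacobi hX hY hZ x
  have h' : (mvfderiv 𝓘(ℝ, E) f x (mlieBracket 𝓘(ℝ, E) X Y x) -
      (mvfderiv 𝓘(ℝ, E) (fun y ↦ mvfderiv 𝓘(ℝ, E) f y (Y y)) x (X x) -
        mvfderiv 𝓘(ℝ, E) (fun y ↦ mvfderiv 𝓘(ℝ, E) f y (X y)) x (Y x))) • Z x = 0 := by
    rw [hJ] at h
    simp only [Pi.add_apply, Pi.smul_apply', smul_add] at h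
    rw [← sub_eq_zero] at h
    rw [← neg_eq_zero]
    refine Eq.trans ?_ h
    module
  have hz : Z x ≠ 0 := by rw [hZx]; exact hv
  exact sub_eq_zero.1 ((smul_eq_zero.1 h').resolve_right hz)

theorem contMDiff_extDeriv₁_apply (β : OneForm E M) {X Y : VField E M} (hX : CMDiff ∞ (T% X))
    (hY : CMDiff ∞ (T% Y)) : CMDiff ∞ (fun y ↦ extDeriv₁ β y (X y) (Y y)) := by
  have h : (fun y ↦ extDeriv₁ β y (X y) (Y y)) = fun y ↦
      mvfderiv 𝓘(ℝ, E) (fun y ↦ β y (Y y)) y (X y) - mvfderiv 𝓘(ℝ, E) (fun y ↦ β y (X y)) y (Y y)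
        - β y (mlieBracket 𝓘(ℝ, E) X Y y) := by
    funext y
    exact extDeriv₁_apply β (mdiffAt_vectorField hX y) (mdiffAt_vectorField hY y)
  rw [h]
  exact ((contMDiff_mvfderiv_apply (contMDiff_oneForm_apply β.contMDiff hY) hX).sub
    (contMDiff_mvfderiv_apply (contMDiff_oneForm_apply β.contMDiff hX) hY)).sub
    (contMDiff_oneForm_apply β.contMDiff (contMDiff_mlieBracket hX hY))

theorem extDeriv₁_swap (β : OneForm E M) (x : M) (u v : TangentSpace 𝓘(ℝ, E) x) :
    extDeriv₁ β x u v = -extDeriv₁ β x v u := by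
  obtain ⟨X, hX, rfl⟩ := exists_vectorField_apply_eq u
  obtain ⟨Y, hY, rfl⟩ := exists_vectorField_apply_eq v
  rw [extDeriv₁_apply β (mdiffAt_vectorField hX x) (mdiffAt_vectorField hY x),
    extDeriv₁_apply β (mdiffAt_vectorField hY x) (mdiffAt_vectorField hX x),
    mlieBracket_swap_apply, map_neg]
  ring

/-- The exterior derivative of an exterior derivative vanishes. -/
theorem extDeriv₁_closed (β : OneForm E M) {X Y Z : VField E M} (hX : CMDiff ∞ (T% X))
    (hY : CMDiff ∞ (T% Y)) (hZ : CMDiff ∞ (T% Z)) (x : M) :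
    mvfderiv 𝓘(ℝ, E) (fun y ↦ extDeriv₁ β y (Y y) (Z y)) x (X x)
      + mvfderiv 𝓘(ℝ, E) (fun y ↦ extDeriv₁ β y (Z y) (X y)) x (Y x)
      + mvfderiv 𝓘(ℝ, E) (fun y ↦ extDeriv₁ β y (X y) (Y y)) x (Z x)
      - extDeriv₁ β x (mlieBracket 𝓘(ℝ, E) X Y x) (Z x)
      - extDeriv₁ β x (mlieBracket 𝓘(ℝ, E) Y Z x) (X x)
      - extDeriv₁ β x (mlieBracket 𝓘(ℝ, E) Z X x) (Y x) = 0 := by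
  have hb {U : VField E M} (hU : CMDiff ∞ (T% U)) : CMDiff ∞ (fun y ↦ β y (U y)) :=
    contMDiff_oneForm_apply β.contMDiff hU
  have e {U V W : VField E M} (hU : CMDiff ∞ (T% U)) (hV : CMDiff ∞ (T% V))
      (hW : CMDiff ∞ (T% W)) :
      mvfderiv 𝓘(ℝ, E) (fun y ↦ extDeriv₁ β y (V y) (W y)) x (U x) =
        mvfderiv 𝓘(ℝ, E) (fun y ↦ mvfderiv 𝓘(ℝ, E) (fun y ↦ β y (W y)) y (V y)) x (U x)
        - mvfderiv 𝓘(ℝ, E) (fun y ↦ mvfderiv 𝓘(ℝ, E) (fun y ↦ β y (V y)) y (W y)) x (U x)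
        - mvfderiv 𝓘(ℝ, E) (fun y ↦ β y (mlieBracket 𝓘(ℝ, E) V W y)) x (U x) := by
    have h : (fun y ↦ extDeriv₁ β y (V y) (W y)) = fun y ↦
        mvfderiv 𝓘(ℝ, E) (fun y ↦ β y (W y)) y (V y)
        - mvfderiv 𝓘(ℝ, E) (fun y ↦ β y (V y)) y (W y)
        - β y (mlieBracket 𝓘(ℝ, E) V W y) := by
      funext y
      exact extDeriv₁_apply β (mdiffAt_vectorField hV y) (mdiffAt_vectorField hW y)
    have h1 := contMDiff_mvfderiv_apply (hb hW) hV
    have h2 := contMDiff_mvfderiv_apply (hb hV) hW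
    rw [h, mvfderiv_fun_sub (mdiffAt_function (h1.sub h2) x)
      (mdiffAt_function (hb (contMDiff_mlieBracket hV hW)) x),
      mvfderiv_fun_sub (mdiffAt_function h1 x) (mdiffAt_function h2 x)]
    rfl
  have e' {U V W : VField E M} (hU : CMDiff ∞ (T% U)) (hV : CMDiff ∞ (T% V))
      (hW : CMDiff ∞ (T% W)) :
      extDeriv₁ β x (mlieBracket 𝓘(ℝ, E) U V x) (W x) =
        mvfderiv 𝓘(ℝ, E) (fun y ↦ mvfderiv 𝓘(ℝ, E) (fun y ↦ β y (W y)) y (V y)) x (U x)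
        - mvfderiv 𝓘(ℝ, E) (fun y ↦ mvfderiv 𝓘(ℝ, E) (fun y ↦ β y (W y)) y (U y)) x (V x)
        - mvfderiv 𝓘(ℝ, E) (fun y ↦ β y (mlieBracket 𝓘(ℝ, E) U V y)) x (W x)
        - β x (mlieBracket 𝓘(ℝ, E) (mlieBracket 𝓘(ℝ, E) U V) W x) := by
    rw [extDeriv₁_apply β (mdiffAt_vectorField (contMDiff_mlieBracket hU hV) x)
      (mdiffAt_vectorField hW x), mvfderiv_apply_mlieBracket (hb hW) hU hV]
  -- In the cyclic sum the second derivatives and the derivatives of `β` on brackets cancel. What is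
  -- left is `β` of the Jacobi sum, so the Leibniz form of the Jacobi identity is rewritten
  -- cyclically.
  have hJ := congrArg (β x) (mlieBracket_jacobi hX hY hZ x)
  rw [mlieBracket_swap_apply (V := X), mlieBracket_swap_apply (V := Y) (W := mlieBracket _ X Z),
    mlieBracket_swap (V := X) (W := Z)] at hJ
  have hs : mlieBracket 𝓘(ℝ, E) (-mlieBracket 𝓘(ℝ, E) Z X) Y x =
      -mlieBracket 𝓘(ℝ, E) (mlieBracket 𝓘(ℝ, E) Z X) Y x := by
    have := mlieBracket_const_smul_left (I := 𝓘(ℝ, E)) (c := (-1 : ℝ)) (W := Y)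
      (mdiffAt_vectorField (contMDiff_mlieBracket hZ hX) x)
    simpa using this
  rw [hs] at hJ
  simp only [map_add, map_neg, neg_neg] at hJ
  rw [e hX hY hZ, e hY hZ hX, e hZ hX hY, e' hX hY hZ, e' hY hZ hX, e' hZ hX hY]
  linear_combination -hJ

end Preliminaries

/-! ### The Levi-Civita connection from the Koszul formula, and its smoothness. -/

section LeviCivita

variable {E : Type*} [NormedAddCommGroup E] [NormedSpace ℝ E]
  {M : Type*} [TopologicalSpace M] [ChartedSpace E M] [IsManifold 𝓘(ℝ, E) ∞ M]

namespace PseudoRiemannianMetric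

variable (g : PseudoRiemannianMetric E M)

theorem mdifferentiableAt_apply {x : M} {Y Z : VField E M} (hY : MDiffAt (T% Y) x)
    (hZ : MDiffAt (T% Z) x) : MDiffAt (fun y ↦ g.val y (Y y) (Z y)) x := by
  have h : MDifferentiableAt 𝓘(ℝ, E) (𝓘(ℝ, E).prod 𝓘(ℝ))
      (fun y ↦ TotalSpace.mk' ℝ (E := Bundle.Trivial M ℝ) y (g.val y (Y y) (Z y))) x := by
    apply MDifferentiableAt.clm_bundle_apply₂ (F₁ := E) (F₂ := E)
    · exact (g.contMDiff x).mdifferentiableAt (by simp)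
    · exact hY
    · exact hZ
  rw [mdifferentiableAt_totalSpace] at h
  exact h.2

theorem contMDiff_apply {Y Z : VField E M} (hY : CMDiff ∞ (T% Y)) (hZ : CMDiff ∞ (T% Z)) :
    CMDiff ∞ (fun y ↦ g.val y (Y y) (Z y)) := by
  have h : ContMDiff 𝓘(ℝ, E) (𝓘(ℝ, E).prod 𝓘(ℝ)) ∞
      (fun y ↦ TotalSpace.mk' ℝ (E := Bundle.Trivial M ℝ) y (g.val y (Y y) (Z y))) := by
    apply ContMDiff.clm_bundle_apply₂ (F₁ := E) (F₂ := E)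
    · exact g.contMDiff
    · exact hY
    · exact hZ
  exact fun x ↦ (contMDiffAt_totalSpace.1 (h x)).2

/-- The derivative along `X` of the function `g(Y, Z)`. -/
def deriv (X Y Z : VField E M) (x : M) : ℝ :=
  mvfderiv 𝓘(ℝ, E) (fun y ↦ g.val y (Y y) (Z y)) x (X x)

theorem deriv_symm (X Y Z : VField E M) (x : M) : g.deriv X Y Z x = g.deriv X Z Y x := by
  simp only [deriv, g.symm _ (Y _) (Z _)]

theorem deriv_add_left (X X' Y Z : VField E M) (x : M) :
    g.deriv (X + X') Y Z x = g.deriv X Y Z x + g.deriv X' Y Z x := by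
  simp [deriv]

theorem deriv_smul_left (f : M → ℝ) (X Y Z : VField E M) (x : M) :
    g.deriv (f • X) Y Z x = f x * g.deriv X Y Z x := by
  simp [deriv]

theorem deriv_add_right (X : VField E M) {Y Z Z' : VField E M} {x : M} (hY : MDiffAt (T% Y) x)
    (hZ : MDiffAt (T% Z) x) (hZ' : MDiffAt (T% Z') x) :
    g.deriv X Y (Z + Z') x = g.deriv X Y Z x + g.deriv X Y Z' x := by
  simp only [deriv, Pi.add_apply, map_add]
  rw [mvfderiv_fun_add (g.mdifferentiableAt_apply hY hZ) (g.mdifferentiableAt_apply hY hZ')]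
  rfl

theorem deriv_smul_right (X : VField E M) {Y Z : VField E M} {f : M → ℝ} {x : M}
    (hf : MDiffAt f x) (hY : MDiffAt (T% Y) x) (hZ : MDiffAt (T% Z) x) :
    g.deriv X Y (f • Z) x =
      f x * g.deriv X Y Z x + mvfderiv 𝓘(ℝ, E) f x (X x) * g.val x (Y x) (Z x) := by
  simp only [deriv, Pi.smul_apply', map_smul, smul_eq_mul]
  rw [mvfderiv_fun_mul hf (g.mdifferentiableAt_apply hY hZ)]
  simp [mul_comm]

/-- The right-hand side of the Koszul formula for `g(∇_X Y, Z)`. -/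
def koszul (X Y Z : VField E M) (x : M) : ℝ :=
  (g.deriv X Y Z x + g.deriv Y X Z x - g.deriv Z X Y x
    + g.val x (mlieBracket 𝓘(ℝ, E) X Y x) (Z x) - g.val x (mlieBracket 𝓘(ℝ, E) X Z x) (Y x)
    - g.val x (mlieBracket 𝓘(ℝ, E) Y Z x) (X x)) / 2

/-- This is metric compatibility of the connection, at the level of the Koszul expression. -/
theorem koszul_add_swap (X Y Z : VField E M) (x : M) :
    g.koszul X Y Z x + g.koszul X Z Y x = g.deriv X Y Z x := by
  simp only [koszul]
  rw [mlieBracket_swap_apply (V := Z) (W := Y), g.deriv_symm X Z Y]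
  simp only [map_neg, _root_.neg_apply]
  ring

/-- This is vanishing of the torsion, at the level of the Koszul expression. It also transfers
properties in the first argument to the second. -/
theorem koszul_sub_swap (X Y Z : VField E M) (x : M) :
    g.koszul X Y Z x - g.koszul Y X Z x = g.val x (mlieBracket 𝓘(ℝ, E) X Y x) (Z x) := by
  simp only [koszul]
  rw [mlieBracket_swap_apply (V := Y) (W := X), g.deriv_symm Z Y X]
  simp only [map_neg, _root_.neg_apply]
  ring

variable [FiniteDimensional ℝ E]

theorem koszul_add_left {X X' Y Z : VField E M} {x : M} (hX : MDiffAt (T% X) x)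
    (hX' : MDiffAt (T% X') x) (hY : MDiffAt (T% Y) x) (hZ : MDiffAt (T% Z) x) :
    g.koszul (X + X') Y Z x = g.koszul X Y Z x + g.koszul X' Y Z x := by
  simp only [koszul]
  rw [g.deriv_symm Y (X + X'), g.deriv_symm Z (X + X'), g.deriv_add_left,
    g.deriv_add_right _ hZ hX hX', g.deriv_add_right _ hY hX hX', mlieBracket_add_left hX hX',
    mlieBracket_add_left hX hX', g.deriv_symm Y X, g.deriv_symm Z X, g.deriv_symm Y X',
    g.deriv_symm Z X']
  simp only [map_add, _root_.add_apply, Pi.add_apply]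
  ring

theorem koszul_smul_left {f : M → ℝ} {X Y Z : VField E M} {x : M} (hf : MDiffAt f x)
    (hX : MDiffAt (T% X) x) (hY : MDiffAt (T% Y) x) (hZ : MDiffAt (T% Z) x) :
    g.koszul (f • X) Y Z x = f x * g.koszul X Y Z x := by
  simp only [koszul]
  rw [g.deriv_symm Y (f • X), g.deriv_symm Z (f • X), g.deriv_smul_left,
    g.deriv_smul_right _ hf hZ hX, g.deriv_smul_right _ hf hY hX, mlieBracket_smul_left hf hX,
    mlieBracket_smul_left hf hX, g.deriv_symm Y X, g.deriv_symm Z X]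
  simp only [map_add, _root_.add_apply, map_smul, _root_.smul_apply, Pi.smul_apply', smul_eq_mul,
    map_neg, _root_.neg_apply, neg_smul]
  rw [g.symm x (Z x) (X x), g.symm x (Y x) (X x)]
  ring

theorem koszul_add_right {X Y Z Z' : VField E M} {x : M} (hX : MDiffAt (T% X) x)
    (hY : MDiffAt (T% Y) x) (hZ : MDiffAt (T% Z) x) (hZ' : MDiffAt (T% Z') x) :
    g.koszul X Y (Z + Z') x = g.koszul X Y Z x + g.koszul X Y Z' x := by
  simp only [koszul]
  rw [g.deriv_add_left, g.deriv_add_right _ hY hZ hZ', g.deriv_add_right _ hX hZ hZ',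
    mlieBracket_add_right hZ hZ', mlieBracket_add_right hZ hZ']
  simp only [map_add, _root_.add_apply, Pi.add_apply]
  ring

theorem koszul_smul_right {f : M → ℝ} {X Y Z : VField E M} {x : M} (hf : MDiffAt f x)
    (hX : MDiffAt (T% X) x) (hY : MDiffAt (T% Y) x) (hZ : MDiffAt (T% Z) x) :
    g.koszul X Y (f • Z) x = f x * g.koszul X Y Z x := by
  simp only [koszul]
  rw [g.deriv_smul_left, g.deriv_smul_right _ hf hY hZ, g.deriv_smul_right _ hf hX hZ,
    mlieBracket_smul_right hf hZ, mlieBracket_smul_right hf hZ]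
  simp only [map_add, _root_.add_apply, map_smul, _root_.smul_apply, Pi.smul_apply', smul_eq_mul]
  rw [g.symm x (Z x) (X x), g.symm x (Z x) (Y x)]
  ring

theorem koszul_add_middle {X Y Y' Z : VField E M} {x : M} (hX : MDiffAt (T% X) x)
    (hY : MDiffAt (T% Y) x) (hY' : MDiffAt (T% Y') x) (hZ : MDiffAt (T% Z) x) :
    g.koszul X (Y + Y') Z x = g.koszul X Y Z x + g.koszul X Y' Z x := by
  have h1 := g.koszul_sub_swap X (Y + Y') Z x
  have h2 := g.koszul_sub_swap X Y Z x
  have h3 := g.koszul_sub_swap X Y' Z x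
  rw [g.koszul_add_left hY hY' hX hZ, mlieBracket_add_right hY hY', map_add,
    _root_.add_apply] at h1
  linear_combination h1 - h2 - h3

/-- Exchanging the first two arguments reduces this to linearity over functions in the first one;
the derivative of `f` comes from the bracket `[X, f Y]`. -/
theorem koszul_smul_middle {f : M → ℝ} {X Y Z : VField E M} {x : M} (hf : MDiffAt f x)
    (hX : MDiffAt (T% X) x) (hY : MDiffAt (T% Y) x) (hZ : MDiffAt (T% Z) x) :
    g.koszul X (f • Y) Z x =
      f x * g.koszul X Y Z x + mvfderiv 𝓘(ℝ, E) f x (X x) * g.val x (Y x) (Z x) := by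
  have h1 := g.koszul_sub_swap X (f • Y) Z x
  have h2 := g.koszul_sub_swap X Y Z x
  rw [g.koszul_smul_left hf hY hX hZ, mlieBracket_smul_right hf hY, map_add, map_smul, map_smul,
    _root_.add_apply, _root_.smul_apply, _root_.smul_apply, smul_eq_mul, smul_eq_mul] at h1
  linear_combination h1 - f x * h2

/-- The Koszul formula as a bilinear form in `X` and `Z`. -/
def koszulHom {Y : VField E M} {x : M} (hY : MDiffAt (T% Y) x) :
    TangentSpace 𝓘(ℝ, E) x →L[ℝ] TangentSpace 𝓘(ℝ, E) x →L[ℝ] ℝ :=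
  TensorialAt.mkHom₂ (I := 𝓘(ℝ, E)) (F := E) (F' := E) (fun X Z ↦ g.koszul X Y Z x) x
    (fun _ hZ ↦ ⟨fun hf hX ↦ g.koszul_smul_left hf hX hY hZ,
      fun hX hX' ↦ g.koszul_add_left hX hX' hY hZ⟩)
    (fun _ hX ↦ ⟨fun hf hZ ↦ g.koszul_smul_right hf hX hY hZ,
      fun hZ hZ' ↦ g.koszul_add_right hX hY hZ hZ'⟩)

theorem koszulHom_apply {X Y Z : VField E M} {x : M} (hX : MDiffAt (T% X) x)
    (hY : MDiffAt (T% Y) x) (hZ : MDiffAt (T% Z) x) :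
    g.koszulHom hY (X x) (Z x) = g.koszul X Y Z x :=
  TensorialAt.mkHom₂_apply _ _ hX hZ

open scoped Classical in
/-- The Levi-Civita derivative of a vector field `Y`; the value is `0` where `Y` is not
differentiable. -/
def leviCivitaAux (Y : VField E M) (x : M) :
    TangentSpace 𝓘(ℝ, E) x →L[ℝ] TangentSpace 𝓘(ℝ, E) x :=
  if hY : MDiffAt (T% Y) x then (sharpMetric g x).comp (g.koszulHom hY) else 0

theorem leviCivitaAux_spec {X Y Z : VField E M} {x : M} (hX : MDiffAt (T% X) x)
    (hY : MDiffAt (T% Y) x) (hZ : MDiffAt (T% Z) x) :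
    g.val x (g.leviCivitaAux Y x (X x)) (Z x) = g.koszul X Y Z x := by
  simp only [leviCivitaAux, dif_pos hY, ContinuousLinearMap.comp_apply]
  rw [(sharpMetric_spec g x).1, g.koszulHom_apply hX hY hZ]

/-- Linear maps into the tangent space are determined by their pairings with differentiable
fields. -/
theorem hom_ext {x : M} {A B : TangentSpace 𝓘(ℝ, E) x →L[ℝ] TangentSpace 𝓘(ℝ, E) x}
    (h : ∀ X Z : VField E M, MDiffAt (T% X) x → MDiffAt (T% Z) x →
      g.val x (A (X x)) (Z x) = g.val x (B (X x)) (Z x)) : A = B := by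
  ext v
  refine sub_eq_zero.1 (g.nondegenerate x _ fun w ↦ ?_)
  have := h (extend E v) (extend E w) (mdifferentiableAt_extend ..) (mdifferentiableAt_extend ..)
  rw [map_sub, _root_.sub_apply, sub_eq_zero]
  simpa using this

/-- The Levi-Civita connection. -/
def leviCivita : CovariantDerivative 𝓘(ℝ, E) E (TangentSpace 𝓘(ℝ, E) : M → Type _) where
  toFun := g.leviCivitaAux
  isCovariantDerivativeOnUniv :=
    { add := fun {Y Y' x} hY hY' _ ↦ g.hom_ext fun X Z hX hZ ↦ by
        rw [g.leviCivitaAux_spec hX (mdifferentiableAt_add_section hY hY') hZ,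
          g.koszul_add_middle hX hY hY' hZ, _root_.add_apply, map_add, _root_.add_apply,
          g.leviCivitaAux_spec hX hY hZ, g.leviCivitaAux_spec hX hY' hZ]
      leibniz := fun {Y f x} hY hf _ ↦ g.hom_ext fun X Z hX hZ ↦ by
        rw [g.leviCivitaAux_spec hX (hf.smul_section hY) hZ, g.koszul_smul_middle hf hX hY hZ]
        simp only [_root_.add_apply, map_add, _root_.smul_apply, map_smul, smul_eq_mul,
          ContinuousLinearMap.smulRight_apply, g.leviCivitaAux_spec hX hY hZ] }

theorem leviCivita_spec {X Y Z : VField E M} {x : M} (hX : MDiffAt (T% X) x)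
    (hY : MDiffAt (T% Y) x) (hZ : MDiffAt (T% Z) x) :
    g.val x (g.leviCivita Y x (X x)) (Z x) = g.koszul X Y Z x :=
  g.leviCivitaAux_spec hX hY hZ

theorem isLeviCivita_leviCivita : IsLeviCivita g g.leviCivita where
  torsion_eq_zero := by
    rw [CovariantDerivative.torsion_eq_zero_iff]
    intro X Y x hX hY
    refine sub_eq_zero.1 (g.nondegenerate x _ fun w ↦ ?_)
    obtain ⟨Z, hZ, rfl⟩ : ∃ Z : VField E M, MDiffAt (T% Z) x ∧ Z x = w :=
      ⟨extend E w, mdifferentiableAt_extend .., by simp⟩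
    simp only [map_sub, _root_.sub_apply, g.leviCivita_spec hX hY hZ, g.leviCivita_spec hY hX hZ,
      g.koszul_sub_swap, sub_self]
  metric x X Y Z hX hY hZ := by
    rw [g.symm x (Y x), g.leviCivita_spec hX hY hZ, g.leviCivita_spec hX hZ hY]
    exact (g.koszul_add_swap X Y Z x).symm

theorem contMDiff_koszul {X Y Z : VField E M} (hX : CMDiff ∞ (T% X)) (hY : CMDiff ∞ (T% Y))
    (hZ : CMDiff ∞ (T% Z)) : CMDiff ∞ (g.koszul X Y Z) := by
  have hd {U V W : VField E M} (hU : CMDiff ∞ (T% U)) (hV : CMDiff ∞ (T% V))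
      (hW : CMDiff ∞ (T% W)) : CMDiff ∞ (g.deriv U V W) :=
    contMDiff_mvfderiv_apply (g.contMDiff_apply hV hW) hU
  have hb {U V W : VField E M} (hU : CMDiff ∞ (T% U)) (hV : CMDiff ∞ (T% V))
      (hW : CMDiff ∞ (T% W)) :
      CMDiff ∞ (fun x ↦ g.val x (mlieBracket 𝓘(ℝ, E) U V x) (W x)) :=
    g.contMDiff_apply (contMDiff_mlieBracket hU hV) hW
  exact (((((hd hX hY hZ).add (hd hY hX hZ)).sub (hd hZ hX hY)).add (hb hX hY hZ)).sub
    (hb hX hZ hY)).sub (hb hY hZ hX) |>.div_const 2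

/-- Raising the index of a smooth 1-form gives a smooth vector field. -/
theorem contMDiff_sharpMetric {a : CovField E M}
    (ha : ContMDiff 𝓘(ℝ, E) (𝓘(ℝ, E).prod 𝓘(ℝ, E →L[ℝ] ℝ)) ∞
      (fun x ↦ TotalSpace.mk' (E →L[ℝ] ℝ) (E := fun x : M ↦ TangentSpace 𝓘(ℝ, E) x →L[ℝ] ℝ) x
        (a x))) : CMDiff ∞ (T% (fun x ↦ sharpMetric g x (a x))) := by
  intro x₀
  let F' : M → Type _ := fun x ↦ TangentSpace 𝓘(ℝ, E) x →L[ℝ] ℝ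
  have hg := (contMDiffAt_hom_bundle (F₁ := E) (E₁ := (TangentSpace 𝓘(ℝ, E) : M → Type _))
    (F₂ := E →L[ℝ] ℝ) (E₂ := F') _).1 (g.contMDiff x₀) |>.2
  refine ContMDiffAt.clm_apply_of_inCoordinates (F₁ := E →L[ℝ] ℝ) (E₁ := F') (b₁ := id)
    (b₂ := id) (F₂ := E) ?_ (ha x₀) contMDiffAt_id
  have hinv : ∀ x, (g.val x).IsInvertible := fun x ↦
    isInvertible_of_injective fun u v huv ↦ by
      rw [← (sharpMetric_spec g x).2 u, huv, (sharpMetric_spec g x).2 v]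
  -- Inversion of continuous linear maps is smooth at invertible ones, so it preserves smoothness of
  -- the coordinate expression of `♭_g`. Near `x₀`, the inverse of that expression is the coordinate
  -- expression of `♯_g`.
  have h1 := (ContDiffAt.contMDiffAt (ContinuousLinearMap.IsInvertible.contDiffAt_map_inverse
    (n := ∞) (𝕜 := ℝ) (E := E) (F := E →L[ℝ] ℝ) ?_)).comp x₀ hg
  · refine h1.congr_of_eventuallyEq ?_
    filter_upwards [(trivializationAt E (TangentSpace 𝓘(ℝ, E)) x₀).open_baseSet.mem_nhds
      (FiberBundle.mem_baseSet_trivializationAt' x₀),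
      (trivializationAt (E →L[ℝ] ℝ) F' x₀).open_baseSet.mem_nhds
      (FiberBundle.mem_baseSet_trivializationAt' x₀)] with x hx hx'
    simp only [Function.comp_apply, id]
    rw [ContinuousLinearMap.inCoordinates_eq hx hx', ContinuousLinearMap.inCoordinates_eq hx' hx]
    simp only [ContinuousLinearMap.inverse_equiv_comp, ContinuousLinearMap.inverse_comp_equiv,
      ContinuousLinearEquiv.symm_symm]
    rfl
  · rw [ContinuousLinearMap.inCoordinates_eq (FiberBundle.mem_baseSet_trivializationAt' x₀)
      (FiberBundle.mem_baseSet_trivializationAt' x₀)]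
    exact ContinuousLinearMap.isInvertible_equiv.comp
      ((hinv x₀).comp ContinuousLinearMap.isInvertible_equiv)

end PseudoRiemannianMetric

variable [FiniteDimensional ℝ E] [T2Space M]

/-- A field of covectors is smooth if its values on smooth vector fields are smooth. -/
theorem contMDiff_covField_of_apply {a : CovField E M}
    (ha : ∀ Z : VField E M, CMDiff ∞ (T% Z) → CMDiff ∞ (fun y ↦ a y (Z y))) :
    ContMDiff 𝓘(ℝ, E) (𝓘(ℝ, E).prod 𝓘(ℝ, E →L[ℝ] ℝ)) ∞
      (fun x ↦ TotalSpace.mk' (E →L[ℝ] ℝ) (E := fun x : M ↦ TangentSpace 𝓘(ℝ, E) x →L[ℝ] ℝ) x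
        (a x)) := by
  intro x₀
  rw [contMDiffAt_hom_bundle (F₁ := E) (E₁ := (TangentSpace 𝓘(ℝ, E) : M → Type _))
    (F₂ := ℝ) (E₂ := Bundle.Trivial M ℝ)]
  refine ⟨contMDiffAt_id, ?_⟩
  let b := Module.finBasis ℝ E
  let t := trivializationAt E (TangentSpace 𝓘(ℝ, E)) x₀
  have hx₀ : x₀ ∈ t.baseSet := FiberBundle.mem_baseSet_trivializationAt' x₀
  have hs (i) : CMDiffAt ∞ (fun y ↦ a y (t.localFrame b i y)) x₀ := by
    -- The frame fields are only local, while the hypothesis concerns global fields; each frame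
    -- field is replaced by a global one with the same germ at `x₀`.
    obtain ⟨Z, hZ, hZs⟩ := exists_contMDiff_section_eventuallyEq (t.open_baseSet.mem_nhds hx₀)
      (t.contMDiffOn_localFrame_baseSet (I := 𝓘(ℝ, E)) ∞ b i)
    refine (ha Z hZ x₀).congr_of_eventuallyEq ?_
    filter_upwards [hZs] with y hy
    rw [hy]
  have hsum : CMDiffAt ∞ (fun y ↦ ∑ i, (a y (t.localFrame b i y)) •
      (LinearMap.toContinuousLinearMap (b.coord i) : E →L[ℝ] ℝ)) x₀ := by
    refine ContMDiffAt.sum fun i _ ↦ ?_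
    exact (hs i).smul contMDiffAt_const
  refine hsum.congr_of_eventuallyEq ?_
  filter_upwards [t.open_baseSet.mem_nhds hx₀] with y hy
  refine ContinuousLinearMap.coe_injective (b.ext fun j ↦ ?_)
  have hy' : y ∈ (trivializationAt ℝ (Bundle.Trivial M ℝ) x₀).baseSet := by simp
  rw [ContinuousLinearMap.inCoordinates_eq hy hy']
  simp only [ContinuousLinearMap.coe_coe, ContinuousLinearMap.comp_apply,
    ContinuousLinearEquiv.coe_coe, FunLike.coe_sum, Finset.sum_apply,
    FunLike.coe_smul, Pi.smul_apply, LinearMap.coe_toContinuousLinearMap',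
    Basis.coord_apply, Basis.repr_self, Finsupp.single_apply, smul_eq_mul, mul_ite, mul_one,
    mul_zero, Finset.sum_ite_eq, Finset.mem_univ, if_true]
  rw [Trivialization.localFrame_apply_of_mem_baseSet (hx := hy)]
  simp [Trivialization.basisAt, t]

/-- Lowering the index gives a covector field whose values on smooth fields are Koszul expressions,
hence smooth; raising the index again preserves smoothness. -/
theorem PseudoRiemannianMetric.contMDiff_leviCivita (g : PseudoRiemannianMetric E M)
    {X Y : VField E M} (hX : CMDiff ∞ (T% X)) (hY : CMDiff ∞ (T% Y)) :
    CMDiff ∞ (T% (fun x ↦ g.leviCivita Y x (X x))) := by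
  have h := g.contMDiff_sharpMetric (contMDiff_covField_of_apply
    (a := fun x ↦ g.val x (g.leviCivita Y x (X x))) fun Z hZ ↦ ?_)
  · simpa only [(sharpMetric_spec g _).2] using h
  · have e : (fun x ↦ g.val x (g.leviCivita Y x (X x)) (Z x)) = g.koszul X Y Z := by
      funext x
      exact g.leviCivita_spec (mdiffAt_vectorField hX x) (mdiffAt_vectorField hY x)
        (mdiffAt_vectorField hZ x)
    rw [e]
    exact g.contMDiff_koszul hX hY hZ

end LeviCivita

/-! ### Algebra of the associated metric, and the bracket of 1-forms. -/

section Contact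

variable {E : Type*} [NormedAddCommGroup E] [NormedSpace ℝ E] [FiniteDimensional ℝ E]
  {M : Type*} [TopologicalSpace M] [ChartedSpace E M] [IsManifold 𝓘(ℝ, E) ∞ M]

theorem cometric_flat_left (g : PseudoRiemannianMetric E M) (x : M)
    (v : TangentSpace 𝓘(ℝ, E) x) (a : Cotangent E x) : cometric g x (g.val x v) a = a v := by
  rw [cometric, (sharpMetric_spec g x).2, g.symm, (sharpMetric_spec g x).1]

theorem cometric_symm (g : PseudoRiemannianMetric E M) (x : M) (a b : Cotangent E x) :
    cometric g x a b = cometric g x b a :=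
  g.symm x _ _

theorem cometric_sub_left (g : PseudoRiemannianMetric E M) (x : M) (a b c : Cotangent E x) :
    cometric g x (a - b) c = cometric g x a c - cometric g x b c := by
  simp [cometric]

theorem cometric_nondegenerate (g : PseudoRiemannianMetric E M) (x : M) (a : Cotangent E x)
    (h : ∀ b, cometric g x a b = 0) : a = 0 := by
  ext v
  rw [← cometric_flat_left g x v a, cometric_symm, h, _root_.zero_apply]

theorem flatEta_apply (η : OneForm E M) (x : M) (u v : TangentSpace 𝓘(ℝ, E) x) :
    flatEta η x u v = -extDeriv₁ η x u v + η x u * η x v := by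
  simp [flatEta]

theorem contactBivector_apply (η : OneForm E M) (x : M) (a b : Cotangent E x) :
    contactBivector η x a b = extDeriv₁ η x (sharpEta η x a) (sharpEta η x b) :=
  rfl

/-- A tensor on 1-forms that is symmetric in its arguments and skew for the cometric vanishes. -/
theorem eq_zero_of_symmetric_of_skew [T2Space M] (g : PseudoRiemannianMetric E M) (x : M)
    (S : OneForm E M → OneForm E M → Cotangent E x) (hsymm : ∀ α β, S α β = S β α)
    (hskew : ∀ α β γ, cometric g x (S α β) (γ x) + cometric g x (β x) (S α γ) = 0)
    (α β : OneForm E M) : S α β = 0 := by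
  refine cometric_nondegenerate g x _ fun b ↦ ?_
  obtain ⟨γ, rfl⟩ := exists_oneForm_apply_eq b
  -- With `T(α, β, γ) = g*(S(α, β), γ)`, symmetry leaves three values, and skewness in the last two
  -- slots for the three cyclic orders makes their pairwise sums vanish.
  have h1 := hskew α β γ
  have h2 := hskew β γ α
  have h3 := hskew γ α β
  rw [cometric_symm g x _ (S _ _)] at h1 h2 h3
  rw [hsymm γ α] at h3
  rw [hsymm β α] at h2
  rw [hsymm γ β] at h3
  linarith

namespace IsAssociatedEndo

variable [T2Space M] {η : OneForm E M} {g : PseudoRiemannianMetric E M} {Phi : EndField E M}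
  (h : IsAssociatedEndo η g Phi)
include h

/-- The inverse of a noninvertible map is by convention zero; the Reeb field would then vanish,
against `η(ξ) = 1`. -/
theorem flatEta_isInvertible (x : M) : (flatEta η x).IsInvertible := by
  by_contra hx
  have h1 := h.1.eta_xi x
  rw [reeb, sharpEta, ContinuousLinearMap.inverse_of_not_isInvertible hx] at h1
  simp at h1

theorem flatEta_sharpEta (x : M) (a : Cotangent E x) : flatEta η x (sharpEta η x a) = a :=
  (h.flatEta_isInvertible x).self_apply_inverse a

theorem sharpEta_flatEta (x : M) (v : TangentSpace 𝓘(ℝ, E) x) :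
    sharpEta η x (flatEta η x v) = v :=
  (h.flatEta_isInvertible x).inverse_apply_self v

/-- Evaluate `♭_η(ξ) = η` on `v` and use `η(ξ) = 1`. -/
theorem extDeriv₁_reeb_left (x : M) (v : TangentSpace 𝓘(ℝ, E) x) :
    extDeriv₁ η x (reeb η x) v = 0 := by
  have h1 := congrArg (· v) (h.flatEta_sharpEta x (η x))
  simp only [flatEta_apply] at h1
  have h2 := h.1.eta_xi x
  rw [reeb] at h2 ⊢
  rw [h2] at h1
  linarith

theorem extDeriv₁_reeb_right (x : M) (v : TangentSpace 𝓘(ℝ, E) x) :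
    extDeriv₁ η x v (reeb η x) = 0 := by
  rw [extDeriv₁_swap, h.extDeriv₁_reeb_left, neg_zero]

theorem apply_reeb (x : M) : Phi x (reeb η x) = 0 := by
  refine g.nondegenerate x _ fun v ↦ ?_
  rw [g.symm, h.2, h.extDeriv₁_reeb_right]

theorem metric_reeb_left (x : M) (v : TangentSpace 𝓘(ℝ, E) x) :
    g.val x (reeb η x) v = η x v := by
  have h1 := h.1.metric x (reeb η x) v
  rw [h.apply_reeb, h.1.eta_xi, map_zero, _root_.zero_apply] at h1
  linarith

theorem metric_reeb_right (x : M) (v : TangentSpace 𝓘(ℝ, E) x) :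
    g.val x v (reeb η x) = η x v := by
  rw [g.symm, h.metric_reeb_left]

theorem eta_apply (x : M) (v : TangentSpace 𝓘(ℝ, E) x) : η x (Phi x v) = 0 := by
  rw [← h.metric_reeb_left, h.2, h.extDeriv₁_reeb_left]

theorem flatEta_eq (x : M) (v : TangentSpace 𝓘(ℝ, E) x) :
    flatEta η x v = g.val x (Phi x v + η x v • reeb η x) := by
  ext w
  rw [flatEta_apply, extDeriv₁_swap, ← h.2, map_add, map_smul, _root_.add_apply,
    _root_.smul_apply, h.metric_reeb_left, g.symm x (Phi x v), smul_eq_mul, neg_neg]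

/-- By `flatEta_eq` it suffices to invert `Φ + η ⊗ ξ`. Its inverse is `-Φ + η ⊗ ξ`, because `Φ² =
-Id + η ⊗ ξ`, `Φξ = 0` and `η ∘ Φ = 0`. -/
theorem sharpEta_eq (x : M) (a : Cotangent E x) :
    sharpEta η x a =
      -Phi x (sharpMetric g x a) + η x (sharpMetric g x a) • reeb η x := by
  have hv (v : TangentSpace 𝓘(ℝ, E) x) : Phi x (-Phi x v + η x v • reeb η x) +
      η x (-Phi x v + η x v • reeb η x) • reeb η x = v := by
    simp only [map_add, map_neg, map_smul, h.1.sq, h.apply_reeb, h.eta_apply, h.1.eta_xi,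
      smul_eq_mul]
    module
  have h1 : a = flatEta η x
      (-Phi x (sharpMetric g x a) + η x (sharpMetric g x a) • reeb η x) := by
    rw [h.flatEta_eq, hv, (sharpMetric_spec g x).1]
  conv_lhs => rw [h1, h.sharpEta_flatEta]

/-- `♯_η` is an isometry. -/
theorem cometric_eq (x : M) (a b : Cotangent E x) :
    cometric g x a b = g.val x (sharpEta η x a) (sharpEta η x b) := by
  rw [h.sharpEta_eq, h.sharpEta_eq, cometric]
  simp only [map_add, map_neg, map_smul, _root_.add_apply, _root_.neg_apply, _root_.smul_apply,
    h.metric_reeb_left, h.metric_reeb_right, h.eta_apply, h.1.eta_xi, h.1.metric, smul_eq_mul]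
  ring

theorem apply_reeb_eq (x : M) (a : Cotangent E x) : a (reeb η x) = η x (sharpEta η x a) := by
  conv_lhs => rw [← h.flatEta_sharpEta x a]
  rw [flatEta_apply, h.extDeriv₁_reeb_right, h.1.eta_xi]
  ring

/-- Pairing the anchor of `a` with a covector `b` gives `dη(♯_η a, ♯_η b) + η(♯_η a) η(♯_η b)`,
which is `♭_η(♯_η b)` evaluated on `♯_η a`, that is `b(♯_η a)`. Covectors separate vectors. -/
theorem anchor_eq (x : M) (a : Cotangent E x) :
    anchor (contactBivector η) (reeb η) x a = sharpEta η x a := by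
  refine sub_eq_zero.1 (g.nondegenerate x _ fun w ↦ ?_)
  have h1 : ∀ b : Cotangent E x,
      b (anchor (contactBivector η) (reeb η) x a) = b (sharpEta η x a) := by
    intro b
    rw [anchor, map_add, map_smul, apply_sharpBiv, contactBivector_apply, h.apply_reeb_eq,
      h.apply_reeb_eq, smul_eq_mul]
    conv_rhs => rw [← h.flatEta_sharpEta x b, flatEta_apply, extDeriv₁_swap]
    ring
  rw [g.symm, map_sub, h1, sub_self]

theorem sharpBiv_eq (x : M) (a : Cotangent E x) :
    sharpBiv (contactBivector η) x a = sharpEta η x a - η x (sharpEta η x a) • reeb η x := by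
  have h1 := h.anchor_eq x a
  rw [anchor, h.apply_reeb_eq] at h1
  exact eq_sub_of_add_eq h1

/-- Up to multiples of `ξ`, which `dη` annihilates, `♯_η` is `-Φ ♯_g`. So `π(♭_g v, ♭_g w) = dη(Φv,
Φw) = g(Φv, Φ²w) = -g(Φv, w)`. -/
theorem endoJ_eq (x : M) (v : TangentSpace 𝓘(ℝ, E) x) :
    endoJ (contactBivector η) g x v = -Phi x v := by
  refine sub_eq_zero.1 (g.nondegenerate x _ fun w ↦ ?_)
  have h1 := endoJ_spec (contactBivector η) g x (g.val x v) (g.val x w)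
  rw [(sharpMetric_spec g x).2, (sharpMetric_spec g x).2, contactBivector_apply, h.sharpEta_eq,
    h.sharpEta_eq, (sharpMetric_spec g x).2, (sharpMetric_spec g x).2] at h1
  simp only [map_add, map_neg, map_smul, _root_.add_apply, _root_.neg_apply, _root_.smul_apply,
    h.extDeriv₁_reeb_left, h.extDeriv₁_reeb_right] at h1
  rw [← h.2 x (Phi x v), h.1.sq] at h1
  simp only [map_add, map_neg, map_smul, h.metric_reeb_right, h.eta_apply] at h1
  rw [map_sub, _root_.sub_apply, h1]
  simp

theorem lambdaForm_eq (x : M) : lambdaForm (contactBivector η) (reeb η) g x = η x := by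
  ext v
  rw [lambdaForm, h.endoJ_eq, h.apply_reeb]
  simp [h.metric_reeb_left, h.1.eta_xi]

theorem contMDiff_sharpEta (α : OneForm E M) :
    CMDiff ∞ (T% (fun x ↦ sharpEta η x (α x))) := by
  have hs := g.contMDiff_sharpMetric α.contMDiff
  have hP : CMDiff ∞ (T% (fun x ↦ Phi x (sharpMetric g x (α x)))) :=
    ContMDiff.clm_bundle_apply (F₁ := E) (F₂ := E) Phi.contMDiff hs
  have h1 := ((contMDiff_const (c := (-1 : ℝ))).smul_section hP).add_section
    ((contMDiff_oneForm_apply η.contMDiff hs).smul_section h.1.smooth)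
  simp only [h.sharpEta_eq]
  convert h1 using 3
  simp

end IsAssociatedEndo

variable [T2Space M]

theorem contMDiff_flatEta (η : OneForm E M) {X : VField E M} (hX : CMDiff ∞ (T% X)) :
    ContMDiff 𝓘(ℝ, E) (𝓘(ℝ, E).prod 𝓘(ℝ, E →L[ℝ] ℝ)) ∞
      (fun x ↦ TotalSpace.mk' (E →L[ℝ] ℝ) (E := fun x : M ↦ TangentSpace 𝓘(ℝ, E) x →L[ℝ] ℝ) x
        (flatEta η x (X x))) := by
  refine contMDiff_covField_of_apply fun Z hZ ↦ ?_
  simp only [flatEta_apply]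
  exact (contMDiff_extDeriv₁_apply η hX hZ).neg.add
    ((contMDiff_oneForm_apply η.contMDiff hX).mul (contMDiff_oneForm_apply η.contMDiff hZ))

namespace IsAssociatedEndo

variable {η : OneForm E M} {g : PseudoRiemannianMetric E M} {Phi : EndField E M}
  (h : IsAssociatedEndo η g Phi)
include h

/-- These two terms of the bracket belong together: their vector arguments add up to `♯_η(α)`, so
the contractions merge into `i_{♯_η α} dβ`, and only differentials of functions remain. -/
theorem lieDeriv_sharpBiv (α β : OneForm E M) (x : M) :
    lieDeriv (fun y ↦ sharpBiv (contactBivector η) y (α y)) β x + α x (reeb η x) •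
      lieDeriv (reeb η) β x =
      mvfderiv 𝓘(ℝ, E) (fun y ↦ extDeriv₁ η y (sharpEta η y (α y)) (sharpEta η y (β y))) x
        + extDeriv₁ β x (sharpEta η x (α x))
        + η x (sharpEta η x (α x)) •
          mvfderiv 𝓘(ℝ, E) (fun y ↦ η y (sharpEta η y (β y))) x := by
  have hb : (fun y ↦ β y (sharpBiv (contactBivector η) y (α y))) =
      fun y ↦ extDeriv₁ η y (sharpEta η y (α y)) (sharpEta η y (β y)) := by
    funext y; rw [apply_sharpBiv, contactBivector_apply]
  have hr : (fun y ↦ β y (reeb η y)) = fun y ↦ η y (sharpEta η y (β y)) := by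
    funext y; rw [h.apply_reeb_eq]
  simp only [lieDeriv, hb, hr]
  rw [h.sharpBiv_eq, h.apply_reeb_eq, map_sub, map_smul]
  module

/-- `♯_η` intertwines the bracket of 1-forms with the Lie bracket of vector fields. -/
theorem skewBracket_eq (α β : OneForm E M) (x : M) :
    skewBracket (contactBivector η) (reeb η) (lambdaForm (contactBivector η) (reeb η) g) α β x =
      flatEta η x (mlieBracket 𝓘(ℝ, E) (fun y ↦ sharpEta η y (α y))
        (fun y ↦ sharpEta η y (β y)) x) := by
  obtain ⟨X, hXdef⟩ : ∃ X : VField E M, X = fun y ↦ sharpEta η y (α y) := ⟨_, rfl⟩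
  obtain ⟨Y, hYdef⟩ : ∃ Y : VField E M, Y = fun y ↦ sharpEta η y (β y) := ⟨_, rfl⟩
  have hX : CMDiff ∞ (T% X) := by rw [hXdef]; exact h.contMDiff_sharpEta α
  have hY : CMDiff ∞ (T% Y) := by rw [hYdef]; exact h.contMDiff_sharpEta β
  have hα : ∀ y v, α y v = -extDeriv₁ η y (X y) v + η y (X y) * η y v := fun y v ↦ by
    rw [← flatEta_apply, hXdef, h.flatEta_sharpEta]
  have hβ : ∀ y v, β y v = -extDeriv₁ η y (Y y) v + η y (Y y) * η y v := fun y v ↦ by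
    rw [← flatEta_apply, hYdef, h.flatEta_sharpEta]
  have e1 := h.lieDeriv_sharpBiv α β x
  have e2 := h.lieDeriv_sharpBiv β α x
  rw [← hXdef, ← hYdef]
  ext z
  obtain ⟨Z, hZ, rfl⟩ := exists_vectorField_apply_eq z
  have e1' := congrArg (· (Z x)) e1
  have e2' := congrArg (· (Z x)) e2
  -- The bracket is expressed through `X` and `Y`. Antisymmetrizing produces the differential of
  -- `dη(X, Y)` twice, and `-d(π(α, β))` removes one copy.
  have key : skewBracket (contactBivector η) (reeb η)
      (lambdaForm (contactBivector η) (reeb η) g) α β x (Z x) =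
      mvfderiv 𝓘(ℝ, E) (fun y ↦ extDeriv₁ η y (X y) (Y y)) x (Z x)
        + extDeriv₁ β x (X x) (Z x) - extDeriv₁ α x (Y x) (Z x)
        + η x (X x) * mvfderiv 𝓘(ℝ, E) (fun y ↦ η y (Y y)) x (Z x)
        - η x (Y x) * mvfderiv 𝓘(ℝ, E) (fun y ↦ η y (X y)) x (Z x)
        - η x (X x) * β x (Z x) + η x (Y x) * α x (Z x)
        - extDeriv₁ η x (X x) (Y x) * η x (Z x) := by
    have hs : (fun y ↦ extDeriv₁ η y (sharpEta η y (β y)) (sharpEta η y (α y))) =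
        fun y ↦ -extDeriv₁ η y (X y) (Y y) := by
      funext y; rw [extDeriv₁_swap, hXdef, hYdef]
    rw [hs, mvfderiv_fun_neg] at e2'
    simp only [_root_.add_apply, _root_.neg_apply, _root_.smul_apply, smul_eq_mul] at e1' e2'
    have hP : (fun y ↦ contactBivector η y (α y) (β y)) =
        fun y ↦ extDeriv₁ η y (X y) (Y y) := by
      funext y; rw [contactBivector_apply, hXdef, hYdef]
    have hPx : contactBivector η x (α x) (β x) = extDeriv₁ η x (X x) (Y x) := congrFun hP x
    have hax : α x (reeb η x) = η x (X x) := by rw [h.apply_reeb_eq, hXdef]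
    have hbx : β x (reeb η x) = η x (Y x) := by rw [h.apply_reeb_eq, hYdef]
    simp only [skewBracket, koszulBracket, h.lambdaForm_eq, _root_.add_apply, _root_.sub_apply,
      _root_.smul_apply, smul_eq_mul, hP, hPx]
    rw [hax] at e1' ⊢
    rw [hbx] at e2' ⊢
    simp only [hXdef, hYdef] at e1' e2' ⊢
    linear_combination e1' - e2'
  rw [key, flatEta_apply]
  have b {U V : VField E M} (hU : CMDiff ∞ (T% U)) (hV : CMDiff ∞ (T% V)) :=
    extDeriv₁_apply η (mdiffAt_vectorField hU x) (mdiffAt_vectorField hV x)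
  have dη {U : VField E M} (hU : CMDiff ∞ (T% U)) : MDiffAt (fun y ↦ η y (U y)) x :=
    mdiffAt_function (contMDiff_oneForm_apply η.contMDiff hU) x
  have dω {U V : VField E M} (hU : CMDiff ∞ (T% U)) (hV : CMDiff ∞ (T% V)) :
      MDiffAt (fun y ↦ extDeriv₁ η y (U y) (V y)) x :=
    mdiffAt_function (contMDiff_extDeriv₁_apply η hU hV) x
  have dform {γ : OneForm E M} {W : VField E M} (hW : CMDiff ∞ (T% W))
      (hγ : ∀ y v, γ y v = -extDeriv₁ η y (W y) v + η y (W y) * η y v)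
      {U : VField E M} (hU : CMDiff ∞ (T% U)) (v : TangentSpace 𝓘(ℝ, E) x) :
      mvfderiv 𝓘(ℝ, E) (fun y ↦ γ y (U y)) x v =
        -mvfderiv 𝓘(ℝ, E) (fun y ↦ extDeriv₁ η y (W y) (U y)) x v
        + η x (W x) * mvfderiv 𝓘(ℝ, E) (fun y ↦ η y (U y)) x v
        + η x (U x) * mvfderiv 𝓘(ℝ, E) (fun y ↦ η y (W y)) x v := by
    simp only [hγ]
    have d1 : MDiffAt (fun y ↦ -extDeriv₁ η y (W y) (U y)) x := (dω hW hU).neg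
    have d2 : MDiffAt (fun y ↦ η y (W y) * η y (U y)) x := (dη hW).mul (dη hU)
    rw [mvfderiv_fun_add d1 d2, mvfderiv_fun_neg, mvfderiv_fun_mul (dη hW) (dη hU)]
    simp only [_root_.add_apply, _root_.neg_apply, _root_.smul_apply, smul_eq_mul]
    ring
  have swap {U V : VField E M} (v : TangentSpace 𝓘(ℝ, E) x) :
      mvfderiv 𝓘(ℝ, E) (fun y ↦ extDeriv₁ η y (U y) (V y)) x v =
        -mvfderiv 𝓘(ℝ, E) (fun y ↦ extDeriv₁ η y (V y) (U y)) x v := by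
    have : (fun y ↦ extDeriv₁ η y (U y) (V y)) = fun y ↦ -extDeriv₁ η y (V y) (U y) := by
      funext y; rw [extDeriv₁_swap]
    rw [this, mvfderiv_fun_neg, _root_.neg_apply]
  rw [extDeriv₁_apply β (mdiffAt_vectorField hX x) (mdiffAt_vectorField hZ x),
    extDeriv₁_apply α (mdiffAt_vectorField hY x) (mdiffAt_vectorField hZ x),
    dform hY hβ hZ, dform hY hβ hX, dform hX hα hZ, dform hX hα hY, hβ, hβ, hα, hα,
    swap (U := Y) (V := X)]
  have hc := extDeriv₁_closed η hX hY hZ x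
  rw [swap (U := Z) (V := X), extDeriv₁_swap η x _ (X x), extDeriv₁_swap η x _ (Y x),
    mlieBracket_swap_apply (V := Z) (W := X), map_neg] at hc
  have b1 := b hX hY
  have b2 := b hX hZ
  have b3 := b hY hZ
  -- Second-order terms cancel by closedness of `dη` on `X, Y, Z`; the products with `η` match by
  -- the formula for `dη` on pairs of fields.
  linear_combination η x (X x) * b3 - η x (Y x) * b2 - η x (Z x) * b1 - hc

end IsAssociatedEndo

end Contact

/-! ### Uniqueness, and transport of the Levi-Civita connection to 1-forms. -/

section ContravariantDerivative

variable {E : Type*} [NormedAddCommGroup E] [NormedSpace ℝ E] [FiniteDimensional ℝ E]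
  {M : Type*} [TopologicalSpace M] [ChartedSpace E M] [IsManifold 𝓘(ℝ, E) ∞ M] [T2Space M]

/-- Contravariant Levi-Civita derivatives are unique. -/
theorem IsContravariantLeviCivita.unique {P : BivField E M} {ξ : VField E M}
    {g : PseudoRiemannianMetric E M} {D : OneForm E M → OneForm E M → OneForm E M}
    (hD : IsContravariantLeviCivita P ξ g D) {D' : OneForm E M → OneForm E M → CovField E M}
    (hsymm : ∀ α β x, D' α β x - D' β α x = skewBracket P ξ (lambdaForm P ξ g) α β x)
    (hmetric : ∀ (α β γ : OneForm E M) (x : M),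
      mvfderiv 𝓘(ℝ, E) (fun y ↦ cometric g y (β y) (γ y)) x (anchor P ξ x (α x)) =
        cometric g x (D' α β x) (γ x) + cometric g x (β x) (D' α γ x))
    (α β : OneForm E M) (x : M) : D α β x = D' α β x := by
  refine sub_eq_zero.1 (eq_zero_of_symmetric_of_skew g x (fun α β ↦ D α β x - D' α β x)
    (fun α β ↦ ?_) (fun α β γ ↦ ?_) α β)
  · rw [sub_eq_sub_iff_sub_eq_sub, hD.symmetric, hsymm]
  · have h1 := hD.metric α β γ x
    rw [hmetric] at h1
    rw [cometric_symm g x (β x)] at h1 ⊢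
    rw [cometric_symm g x (β x)] at h1
    rw [cometric_sub_left, cometric_sub_left]
    linarith

namespace IsAssociatedEndo

variable {η : OneForm E M} {g : PseudoRiemannianMetric E M} {Phi : EndField E M}
  (h : IsAssociatedEndo η g Phi)
  {nabla : CovariantDerivative 𝓘(ℝ, E) E (TangentSpace 𝓘(ℝ, E) : M → Type _)}
include h

theorem flatEta_leviCivita_symmetric (hn : IsLeviCivita g nabla) (α β : OneForm E M) (x : M) :
    flatEta η x (nabla (fun y ↦ sharpEta η y (β y)) x (sharpEta η x (α x)))
      - flatEta η x (nabla (fun y ↦ sharpEta η y (α y)) x (sharpEta η x (β x))) =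
      skewBracket (contactBivector η) (reeb η) (lambdaForm (contactBivector η) (reeb η) g) α β x := by
  rw [h.skewBracket_eq, ← map_sub]
  congr 1
  exact (CovariantDerivative.torsion_eq_zero_iff nabla).1 hn.torsion_eq_zero
    (mdiffAt_vectorField (h.contMDiff_sharpEta α) x)
    (mdiffAt_vectorField (h.contMDiff_sharpEta β) x)

theorem flatEta_leviCivita_metric (hn : IsLeviCivita g nabla) (α β γ : OneForm E M) (x : M) :
    mvfderiv 𝓘(ℝ, E) (fun y ↦ cometric g y (β y) (γ y)) x
        (anchor (contactBivector η) (reeb η) x (α x)) =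
      cometric g x (flatEta η x (nabla (fun y ↦ sharpEta η y (β y)) x (sharpEta η x (α x)))) (γ x)
      + cometric g x (β x)
        (flatEta η x (nabla (fun y ↦ sharpEta η y (γ y)) x (sharpEta η x (α x)))) := by
  simp only [h.cometric_eq, h.sharpEta_flatEta, h.anchor_eq]
  exact hn.metric x _ _ _ (mdiffAt_vectorField (h.contMDiff_sharpEta α) x)
    (mdiffAt_vectorField (h.contMDiff_sharpEta β) x)
    (mdiffAt_vectorField (h.contMDiff_sharpEta γ) x)

/-- Uniqueness is applied to `♭_η(∇_{♯_η α} ♯_η β)`. For an arbitrary `nabla` this is only known to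
be a field of covectors, which is why the competitor `D'` in `IsContravariantLeviCivita.unique`
takes values in `CovField`. -/
theorem sharpEta_eq_leviCivita (hn : IsLeviCivita g nabla)
    {D : OneForm E M → OneForm E M → OneForm E M}
    (hD : IsContravariantLeviCivita (contactBivector η) (reeb η) g D) (α β : OneForm E M) (x : M) :
    sharpEta η x (D α β x) =
      nabla (fun y ↦ sharpEta η y (β y)) x (sharpEta η x (α x)) := by
  rw [hD.unique (h.flatEta_leviCivita_symmetric hn) (h.flatEta_leviCivita_metric hn),
    h.sharpEta_flatEta]

/-- The Levi-Civita connection transported to 1-forms by `♭_η`. -/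
def contravariantDeriv (α β : OneForm E M) : OneForm E M :=
  ⟨fun x ↦ flatEta η x (g.leviCivita (fun y ↦ sharpEta η y (β y)) x (sharpEta η x (α x))),
    contMDiff_flatEta η (g.contMDiff_leviCivita (h.contMDiff_sharpEta α)
      (h.contMDiff_sharpEta β))⟩

theorem contravariantDeriv_apply (α β : OneForm E M) (x : M) :
    h.contravariantDeriv α β x =
      flatEta η x (g.leviCivita (fun y ↦ sharpEta η y (β y)) x (sharpEta η x (α x))) :=
  rfl

theorem isContravariantLeviCivita_contravariantDeriv :
    IsContravariantLeviCivita (contactBivector η) (reeb η) g h.contravariantDeriv where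
  add_left α α' β := by
    ext x : 1
    simp only [ContMDiffSection.coe_add, Pi.add_apply, contravariantDeriv_apply, map_add]
  smul_left f α β := by
    ext x : 1
    change flatEta η x (g.leviCivita _ x (sharpEta η x (f x • α x))) = f x • flatEta η x _
    rw [map_smul, map_smul, map_smul]
  add_right α β β' := by
    ext x : 1
    have e : (fun y ↦ sharpEta η y (β y + β' y)) =
        (fun y ↦ sharpEta η y (β y)) + fun y ↦ sharpEta η y (β' y) := by
      funext y; exact map_add _ _ _
    simp only [ContMDiffSection.coe_add, Pi.add_apply, contravariantDeriv_apply]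
    rw [e, g.leviCivita.isCovariantDerivativeOnUniv.add
      (mdiffAt_vectorField (h.contMDiff_sharpEta β) x)
      (mdiffAt_vectorField (h.contMDiff_sharpEta β') x), _root_.add_apply, map_add]
  leibniz f α β x := by
    have e : (fun y ↦ sharpEta η y (fsmul f β y)) =
        (f : M → ℝ) • fun y ↦ sharpEta η y (β y) := by
      funext y; exact map_smul _ _ _
    simp only [contravariantDeriv_apply]
    rw [e, g.leviCivita.isCovariantDerivativeOnUniv.leibniz
      (mdiffAt_vectorField (h.contMDiff_sharpEta β) x) (mdiffAt_function f.contMDiff x),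
      _root_.add_apply, map_add, _root_.smul_apply, map_smul, ContinuousLinearMap.smulRight_apply,
      map_smul, h.flatEta_sharpEta, h.anchor_eq]
  symmetric α β x := h.flatEta_leviCivita_symmetric g.isLeviCivita_leviCivita α β x
  metric α β γ x := h.flatEta_leviCivita_metric g.isLeviCivita_leviCivita α β γ x

end IsAssociatedEndo

end ContravariantDerivative

end ContactJacobi

end

theorem mainTheorem9 {E : Type*} [NormedAddCommGroup E] [NormedSpace ℝ E] [FiniteDimensional ℝ E]
    {M : Type*} [TopologicalSpace M] [T2Space M] [ChartedSpace E M] [IsManifold 𝓘(ℝ, E) ∞ M]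
    (n : ℕ) (hn : 1 ≤ n) (η : OneForm E M) (g : PseudoRiemannianMetric E M)
    (h : IsContactPseudoRiemannian n η g) :
    (∃! D : OneForm E M → OneForm E M → OneForm E M,
      IsContravariantLeviCivita (contactBivector η) (reeb η) g D) ∧
    (∃ nabla : CovariantDerivative 𝓘(ℝ, E) E (TangentSpace 𝓘(ℝ, E) : M → Type _),
      IsLeviCivita g nabla) ∧
    (∀ (D : OneForm E M → OneForm E M → OneForm E M)
      (nabla : CovariantDerivative 𝓘(ℝ, E) E (TangentSpace 𝓘(ℝ, E) : M → Type _)),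
      IsContravariantLeviCivita (contactBivector η) (reeb η) g D → IsLeviCivita g nabla →
      ∀ (α β : OneForm E M) (x : M),
        sharpEta η x (D α β x) =
          nabla (fun y ↦ sharpEta η y (β y)) x (sharpEta η x (α x))) ∧
    (∀ x : M, lambdaForm (contactBivector η) (reeb η) g x = η x) ∧
    (∀ Phi : EndField E M, IsAssociatedEndo η g Phi →
      ∀ (x : M) (v : TangentSpace 𝓘(ℝ, E) x),
        Phi x v = -endoJ (contactBivector η) g x v) := by
  obtain ⟨-, Phi, hPhi⟩ := h
  refine ⟨⟨hPhi.contravariantDeriv, hPhi.isContravariantLeviCivita_contravariantDeriv,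
    fun D hD ↦ ?_⟩, ⟨g.leviCivita, g.isLeviCivita_leviCivita⟩,
    fun D _ hD hn ↦ hPhi.sharpEta_eq_leviCivita hn hD, hPhi.lambdaForm_eq,
    fun Psi hPsi x v ↦ by rw [hPsi.endoJ_eq, neg_neg]⟩
  funext α β
  ext x : 1
  exact hD.unique hPhi.isContravariantLeviCivita_contravariantDeriv.symmetric
    hPhi.isContravariantLeviCivita_contravariantDeriv.metric α β x
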